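/- Let $G=(V,E)$ be a UCCG, i.e. a finite undirected connected chordal graph (no set of four or more vertices induces a cycle). An AMO (acyclic moral orientation) of an undirected graph $H$ is obtained by replacing each edge of $H$ by a directed one such that there is no directed cycle and no induced subgraph $a\to b\leftarrow c$; $\#\mathrm{AMO}(H)$ is the number of AMOs of $H$. A topological ordering of an AMO $\alpha$ is a linear ordering of all vertices in which $u$ precedes $v$ for each edge $u\to v$ of $\alpha$. For a clique $K$ of $G$ and a permutation $\pi$ of $K$, let $G^{\pi}$ be the union (of edge sets) of all AMOs of $G$ that have a topological ordering beginning with $\pi$, and let $G^K=\bigcup_\pi G^{\pi}$. Let $\mathcal C_G(K)$ be the set of undirected connected components of $G^K[V\setminus K]$, that is, the connected components of the graph on $V\setminus K$ formed by the edges that occur in both directions in $G^K$. A rooted clique tree $\mathcal T=(T,r,\iota)$ of $G$ consists of a tree $T$ with root $r$ and a bijection $\iota$ from the nodes $V_T$ of $T$ to the maximal cliques of $G$ such that for every $v\in V$ the set $\{x\in V_T\mid v\in\iota(x)\}$ is connected in $T$. For a node $v$ with root path $r=x_1,\dots,x_p=v$, let $\mathrm{FP}(v,\mathcal T)$ be the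 set of all $\iota(x_i)\cap\iota(x_{i+1})$, $1\le i<p$, that are contained in $\iota(v)$. For a set $S$ and a collection $R$ of subsets of $S$, let $\varphi(S,R)$ be the number of permutations of $S$ that have no set $S'\in R$ as a prefix. (1) For every rooted clique tree $\mathcal T=(T,r,\iota)$ of $G$, $$\#\mathrm{AMO}(G)=\sum_{v\in V_T}\varphi\bigl(\iota(v),\mathrm{FP}(v,\mathcal T)\bigr)\cdot\prod_{H\in\mathcal C_G(\iota(v))}\#\mathrm{AMO}(H).$$ (2) The algorithm Clique-Picking on input $G$ terminates and returns $\#\mathrm{AMO}(G)$, whatever choices are made in its execution. Clique-Picking calls $\mathrm{count}(G)$ with an empty table $\mathrm{memo}$ shared by all calls, where $\mathrm{count}(H)$ is the following procedure: if $\mathrm{memo}[H]$ is defined, return it; otherwise take any rooted clique tree $\mathcal T=(T,r,\iota)$ of $H$, set $\mathrm{sum}\gets 0$ and let $Q$ be a queue containing only $r$; while $Q$ is not empty, pop a node $v$ from $Q$, push the children of $v$ to $Q$, set $\mathrm{prod}\gets 1$, replace $\mathrm{prod}$ by $\mathrm{prod}\cdot\mathrm{count}(H')$ for each $H'\in\mathcal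 C_H(\iota(v))$ in turn, and then add $\varphi(\iota(v),\mathrm{FP}(v,\mathcal T))\cdot\mathrm{prod}$ to $\mathrm{sum}$; finally set $\mathrm{memo}[H]\gets\mathrm{sum}$ and return $\mathrm{sum}$. -/

import Mathlib

universe u w

namespace CliquePicking

/-! ### Chordal graphs -/

/-- No set of four or more vertices induces a cycle. -/
def IsChordal {V : Type u} (G : SimpleGraph V) : Prop :=
  ∀ n : ℕ, 4 ≤ n → IsEmpty (SimpleGraph.cycleGraph n ↪g G)

/-- Undirected connected chordal graphs. -/
structure IsUCCG {V : Type u} (G : SimpleGraph V) : Prop where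
  connected : G.Connected
  chordal : IsChordal G

/-- The set `Π(G)` of maximal cliques. -/
def maxCliques {V : Type u} (G : SimpleGraph V) : Set (Set V) :=
  {K | Maximal G.IsClique K}

/-! ### Acyclic moral orientations

Partially directed graphs are digraphs: `u - v` is undirected if both `(u, v)` and `(v, u)` are
edges, and `u → v` is directed if only `(u, v)` is an edge. -/

/-- `D` arises from `G` by replacing each undirected edge with a directed one. -/
def IsOrientation {V : Type u} (G : SimpleGraph V) (D : Digraph V) : Prop :=
  (∀ u v, D.Adj u v → G.Adj u v) ∧ ∀ u v, G.Adj u v → Xor (D.Adj u v) (D.Adj v u)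

/-- No directed cycles. -/
def IsAcyclic {V : Type u} (D : Digraph V) : Prop :=
  ∀ v, ¬ Relation.TransGen D.Adj v v

/-- The triple `(a, b, c)` induces the subgraph `a → b ← c`. -/
def IsVStructure {V : Type u} (D : Digraph V) (a b c : V) : Prop :=
  a ≠ c ∧ (D.Adj a b ∧ ¬ D.Adj b a) ∧ (D.Adj c b ∧ ¬ D.Adj b c) ∧ ¬ D.Adj a c ∧ ¬ D.Adj c a

/-- `D` is an acyclic moral orientation of `G`. -/
structure IsAMO {V : Type u} (G : SimpleGraph V) (D : Digraph V) : Prop where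
  orientation : IsOrientation G D
  acyclic : IsAcyclic D
  moral : ∀ a b c, ¬ IsVStructure D a b c

/-- The number `#AMO(G)` of acyclic moral orientations of `G`. -/
noncomputable def numAMO {V : Type u} (G : SimpleGraph V) : ℕ :=
  {D : Digraph V | IsAMO G D}.ncard

/-! ### Permutations and topological orderings -/

/-- The list `π` is a permutation of the set `S`. -/
def IsPermutationOf {V : Type u} (π : List V) (S : Set V) : Prop :=
  π.Nodup ∧ ∀ x, x ∈ π ↔ x ∈ S

/-- `τ` is a linear ordering of all vertices in which `u` precedes `v` for each edge `u → v`. -/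
def IsTopologicalOrdering {V : Type u} (D : Digraph V) (τ : List V) : Prop :=
  IsPermutationOf τ Set.univ ∧ ∀ u v, D.Adj u v → [u, v].Sublist τ

/-- `φ(S, R)`: the number of permutations of `S` that have no set `S' ∈ R` as prefix. -/
noncomputable def phi {V : Type u} (S : Set V) (R : Set (Set V)) : ℕ :=
  {π : List V | IsPermutationOf π S ∧
    ∀ S' ∈ R, ¬ ∃ σ : List V, σ <+: π ∧ IsPermutationOf σ S'}.ncard

/-! ### The graph `G^K` and its undirected components -/

/-- `G^π`: the union of all AMOs of `G` that can be represented by a topological ordering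
beginning with `π`. -/
def permOrientation {V : Type u} (G : SimpleGraph V) (π : List V) : Digraph V :=
  sSup {D | IsAMO G D ∧ ∃ τ : List V, IsTopologicalOrdering D τ ∧ π <+: τ}

/-- `G^K`: the union of the graphs `G^π` over all permutations `π` of `K`. -/
def cliqueOrientation {V : Type u} (G : SimpleGraph V) (K : Set V) : Digraph V :=
  sSup {D | ∃ π : List V, IsPermutationOf π K ∧ D = permOrientation G π}

/-- The undirected edges of `G^K[V \ K]` (as a graph on all of `V`). -/
def undirectedRest {V : Type u} (G : SimpleGraph V) (K : Set V) : SimpleGraph V :=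
  ((cliqueOrientation G K).toSimpleGraphStrict.induce Kᶜ).spanningCoe

theorem undirectedRest_le {V : Type u} (G : SimpleGraph V) (K : Set V) :
    undirectedRest G K ≤ G := by
  intro a b h
  obtain ⟨_, x, y, hxy, rfl, rfl⟩ := h
  have h' : (cliqueOrientation G K).Adj x y := hxy.2.1
  obtain ⟨D, ⟨π, _, rfl⟩, hD⟩ := h'
  obtain ⟨D', ⟨hA, _⟩, hD'⟩ := hD
  exact hA.orientation.1 _ _ hD'

/-- The undirected component of `G^K[V \ K]` that contains the vertex `x ∉ K`: its vertices are
those connected to `x` by undirected edges, its edges are the undirected edges between them. -/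
def componentAt {V : Type u} (G : SimpleGraph V) (K : Set V) (x : V) : G.Subgraph where
  verts := {y | (undirectedRest G K).Reachable x y}
  Adj a b := (undirectedRest G K).Reachable x a ∧ (undirectedRest G K).Adj a b
  adj_sub h := undirectedRest_le G K h.2
  edge_vert h := h.1
  symm := ⟨fun _ _ h => ⟨h.1.trans h.2.reachable, h.2.symm⟩⟩

/-- `C_G(K)`: the set of undirected connected components of `G^K[V \ K]`. -/
def components {V : Type u} (G : SimpleGraph V) (K : Set V) : Set G.Subgraph :=
  {H | ∃ x ∉ K, H = componentAt G K x}

/-! ### Rooted clique trees -/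

/-- A rooted clique tree `(T, r, ι)` of `G`. -/
structure RootedCliqueTree {V : Type u} (G : SimpleGraph V) where
  Node : Type w
  tree : SimpleGraph Node
  isTree : tree.IsTree
  root : Node
  bag : Node → Set V
  bag_bijOn : Set.BijOn bag Set.univ (maxCliques G)
  connected : ∀ v : V, (tree.induce {x | v ∈ bag x}).Connected

namespace RootedCliqueTree

/-- The children of `x`: the neighbours of `x` that are farther from the root. -/
def children {V : Type u} {G : SimpleGraph V} (T : RootedCliqueTree.{u, w} G) (x : T.Node) :
    Set T.Node :=
  {y | T.tree.Adj x y ∧ T.tree.dist T.root x < T.tree.dist T.root y}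

/-- `FP(x, T)`: the intersections `ι(x_i) ∩ ι(x_{i+1})` of consecutive bags on the path from the
root to `x` that are contained in `ι(x)`. -/
def forbiddenPrefixes {V : Type u} {G : SimpleGraph V} (T : RootedCliqueTree.{u, w} G)
    (x : T.Node) : Set (Set V) :=
  {S | ∃ p : T.tree.Walk T.root x, p.IsPath ∧ ∃ i < p.length,
    S = T.bag (p.getVert i) ∩ T.bag (p.getVert (i + 1)) ∧ S ⊆ T.bag x}

end RootedCliqueTree

/-! ### The algorithm Clique-Picking

The algorithm is modelled as a nondeterministic abstract machine with a call stack and a shared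
memo table; the nondeterminism covers every choice of a clique tree, of the order in which children
are pushed to the queue and of the order in which the components are visited. All graphs on which
`count` is called are subgraphs of the input graph `G`. -/

/-- The local variables of a call of `count` that is at the head of, or suspended within, its
for-each loop: the graph `H`, its clique tree, the queue, the value of `sum`, the current node `v`,
the components not yet treated and the value of `prod`. -/
structure Frame {V : Type u} (G : SimpleGraph V) where
  graph : G.Subgraph
  cliqueTree : RootedCliqueTree.{u, w} graph.coe
  queue : List cliqueTree.Node
  sum : ℕ
  node : cliqueTree.Node
  todo : List G.Subgraph
  prod : ℕ

/-- What the machine does next. -/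
inductive Control {V : Type u} (G : SimpleGraph V) : Type (max u (w + 1))
  /-- Enter `count(H, memo)`. -/
  | call (H : G.Subgraph) : Control G
  /-- At the head of the while loop of a call of `count` on `H`. -/
  | whileLoop (H : G.Subgraph) (T : RootedCliqueTree.{u, w} H.coe) (queue : List T.Node)
      (sum : ℕ) : Control G
  /-- At the head of the for-each loop. -/
  | forEach (F : Frame.{u, w} G) : Control G
  /-- A call of `count` has just returned the value `n`. -/
  | ret (n : ℕ) : Control G

/-- A state: the control, the stack of suspended calls and the memo table. -/
structure State {V : Type u} (G : SimpleGraph V) where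
  control : Control.{u, w} G
  stack : List (Frame.{u, w} G)
  memo : G.Subgraph → Option ℕ

/-- `memo[H] = n`. -/
noncomputable def memoSet {V : Type u} {G : SimpleGraph V} (memo : G.Subgraph → Option ℕ)
    (H : G.Subgraph) (n : ℕ) : G.Subgraph → Option ℕ :=
  letI := Classical.decEq G.Subgraph
  Function.update memo H (some n)

/-- The steps of Clique-Picking. -/
inductive Step {V : Type u} {G : SimpleGraph V} : State.{u, w} G → State.{u, w} G → Prop
  /-- `if G ∈ memo then return memo[G]` -/
  | lookup (H : G.Subgraph) (stack : List (Frame.{u, w} G)) (memo : G.Subgraph → Option ℕ) (n : ℕ)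
      (h : memo H = some n) :
      Step ⟨.call H, stack, memo⟩ ⟨.ret n, stack, memo⟩
  /-- Choose any rooted clique tree; `sum ← 0`; `Q ← ` queue with single element `r`. -/
  | start (H : G.Subgraph) (stack : List (Frame.{u, w} G)) (memo : G.Subgraph → Option ℕ)
      (h : memo H = none) (T : RootedCliqueTree.{u, w} H.coe) :
      Step ⟨.call H, stack, memo⟩ ⟨.whileLoop H T [T.root] 0, stack, memo⟩
  /-- `v ← pop(Q)`; `push(Q, children(v))`; `prod ← 1`; start iterating over `C_H(ι(v))`. -/
  | pop (H : G.Subgraph) (T : RootedCliqueTree.{u, w} H.coe) (v : T.Node) (queue : List T.Node)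
      (sum : ℕ) (stack : List (Frame.{u, w} G)) (memo : G.Subgraph → Option ℕ)
      (newNodes : List T.Node) (hn : IsPermutationOf newNodes (T.children v))
      (todo : List G.Subgraph)
      (ht : IsPermutationOf todo
        (SimpleGraph.Subgraph.coeSubgraph '' components H.coe (T.bag v))) :
      Step ⟨.whileLoop H T (v :: queue) sum, stack, memo⟩
        ⟨.forEach ⟨H, T, queue ++ newNodes, sum, v, todo, 1⟩, stack, memo⟩
  /-- Call `count` on the next component. -/
  | recurse (H : G.Subgraph) (T : RootedCliqueTree.{u, w} H.coe) (queue : List T.Node) (sum : ℕ)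
      (v : T.Node) (H' : G.Subgraph) (todo : List G.Subgraph) (prod : ℕ)
      (stack : List (Frame.{u, w} G)) (memo : G.Subgraph → Option ℕ) :
      Step ⟨.forEach ⟨H, T, queue, sum, v, H' :: todo, prod⟩, stack, memo⟩
        ⟨.call H', ⟨H, T, queue, sum, v, todo, prod⟩ :: stack, memo⟩
  /-- `prod ← prod * ` the value returned by the recursive call. -/
  | resume (n : ℕ) (H : G.Subgraph) (T : RootedCliqueTree.{u, w} H.coe) (queue : List T.Node)
      (sum : ℕ) (v : T.Node) (todo : List G.Subgraph) (prod : ℕ)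
      (stack : List (Frame.{u, w} G)) (memo : G.Subgraph → Option ℕ) :
      Step ⟨.ret n, ⟨H, T, queue, sum, v, todo, prod⟩ :: stack, memo⟩
        ⟨.forEach ⟨H, T, queue, sum, v, todo, prod * n⟩, stack, memo⟩
  /-- `sum ← sum + φ(ι(v), FP(v, T)) * prod` -/
  | addTerm (H : G.Subgraph) (T : RootedCliqueTree.{u, w} H.coe) (queue : List T.Node) (sum : ℕ)
      (v : T.Node) (prod : ℕ) (stack : List (Frame.{u, w} G)) (memo : G.Subgraph → Option ℕ) :
      Step ⟨.forEach ⟨H, T, queue, sum, v, [], prod⟩, stack, memo⟩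
        ⟨.whileLoop H T queue (sum + phi (T.bag v) (T.forbiddenPrefixes v) * prod), stack, memo⟩
  /-- The queue is empty: `memo[G] = sum`; `return sum`. -/
  | finish (H : G.Subgraph) (T : RootedCliqueTree.{u, w} H.coe) (sum : ℕ)
      (stack : List (Frame.{u, w} G)) (memo : G.Subgraph → Option ℕ) :
      Step ⟨.whileLoop H T [] sum, stack, memo⟩ ⟨.ret sum, stack, memoSet memo H sum⟩

/-- The start of `count(G, ∅)`. -/
def initialState {V : Type u} (G : SimpleGraph V) : State.{u, w} G :=
  ⟨.call ⊤, [], fun _ => none⟩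

/-- On input `G`, whatever choices are made, Clique-Picking terminates and returns `n`: no run is
infinite, and a reachable state without a successor is one in which the outermost call has
returned `n`. -/
def AlwaysReturns {V : Type u} (G : SimpleGraph V) (n : ℕ) : Prop :=
  (¬ ∃ s : ℕ → State.{u, w} G, s 0 = initialState G ∧ ∀ i, Step (s i) (s (i + 1))) ∧
  ∀ s : State.{u, w} G, Relation.ReflTransGen Step (initialState G) s →
    (∃ s', Step s s') ∨ ∃ memo, s = ⟨.ret n, [], memo⟩

end CliquePicking

/-!
Call a set of vertices *initial* in a digraph if it is closed under predecessors (`IsInitial`). An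
AMO has a topological ordering beginning with a permutation of the clique `K` if and only if `K` is
initial in it, so the graph `G^K` is the union of the AMOs in which `K` is initial.

*AMOs with a given initial clique* (`ncard_isAMO_isInitial`). By Dirac's lemma
(`IsChordal.exists_simplicial`) there is at least one AMO in which `K` is initial. In all of these
AMOs the edges leaving `K` are directed away from `K`, and if `z → x` is forced and `z`, `y` are
not adjacent, then `x → y` is forced as well (`Forced`). Vertices joined by an unforced edge have
the same forced predecessors (`Forced.of_residual_adj`). Therefore the forced edges can be combined
with an arbitrary AMO of the unforced ones (`isAMO_glue`), and the components of unforced edges are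
induced subgraphs of `G`. They are thus chordal, so that each of their edges occurs in both
directions: the graph of unforced edges is exactly the undirected part of `G^K`
(`undirectedRest_adj_iff`). An AMO in which `K` is initial is therefore the same as a permutation
of `K` together with an AMO of each member of `C_G(K)`.

*Each AMO is counted once.* For an AMO `D` and a rooted clique tree there is exactly one node `v`
such that the bag of `v` is initial and no member of `FP(v)` is. Existence
(`RootedCliqueTree.exists_isInitial_bag`) is shown for growing subtrees that contain the root. For
uniqueness (`RootedCliqueTree.eq_of_isInitial_bag`), two initial bags with intersection `S` are not
connected outside `S`, because adjacent vertices have a common ancestor and the ancestors of any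
vertex form a chain (`IsAMO.reflTransGen_or`); hence `S` is the intersection of two adjacent bags
on the tree path between them, and lies in `FP` of one of the two nodes. Summing over the nodes
gives the formula `numAMO_eq_finsum`.

*The algorithm.* A run can get stuck only if there is no clique tree to choose; chordal graphs have
one, built by adding simplicial vertices (`IsChordal.nonempty_rootedCliqueTree`). Total correctness
(`callSpec`) is proved by induction on the number of vertices of the graph on which `count` is
called: the state from which a call starts returns the right result if all states in which that
call has returned the right number, with a correct table, do.
-/

namespace CliquePicking
open SimpleGraph

/-! ### Chordal graphs: simplicial vertices -/

theorem induce_spanningCoe_adj {V : Type u} {G : SimpleGraph V} {s : Set V} {a b : V} :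
    (G.induce s).spanningCoe.Adj a b ↔ a ∈ s ∧ b ∈ s ∧ G.Adj a b := by
  constructor
  · rintro ⟨_, x, y, h, rfl, rfl⟩
    exact ⟨x.2, y.2, h⟩
  · rintro ⟨ha, hb, h⟩
    exact ⟨h.ne, ⟨a, ha⟩, ⟨b, hb⟩, h, rfl, rfl⟩

theorem val_sub_eq_one_iff {n : ℕ} (hn : 2 ≤ n) (a b : Fin n) :
    (a - b).val = 1 ↔ a.val = b.val + 1 ∨ (a.val = 0 ∧ b.val = n - 1) := by
  have ha := a.2
  have hb := b.2
  rw [Fin.sub_def]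
  simp only
  by_cases h : b.val ≤ a.val
  · have : n - b.val + a.val = (a.val - b.val) + n := by omega
    rw [this, Nat.add_mod_right, Nat.mod_eq_of_lt (by omega)]
    omega
  · rw [Nat.mod_eq_of_lt (by omega)]
    omega

/-- In a chordal graph, two neighbours `x`, `y` of `v` that are joined by a walk through
non-neighbours of `v` are adjacent: otherwise a shortest such walk closes up, through `v`, to an
induced cycle of length at least four. -/
theorem IsChordal.adj_of_reachable {V : Type u} {G : SimpleGraph V} (hG : IsChordal G)
    {v x y : V} {C : Set V} (hC : ∀ c ∈ C, c ≠ v ∧ ¬ G.Adj v c) (hvx : G.Adj v x)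
    (hvy : G.Adj v y) (hxy : x ≠ y)
    (hr : (G.induce (C ∪ {x, y})).spanningCoe.Reachable x y) : G.Adj x y := by
  by_contra hnadj
  set H := (G.induce (C ∪ {x, y})).spanningCoe with hH
  obtain ⟨p, hp⟩ := hr.exists_walk_length_eq_dist
  have hpath := p.isPath_of_length_eq_dist hp
  have hlen : 1 < p.length := by
    rw [hp]
    refine hr.one_lt_dist_of_ne_of_not_adj hxy fun h => hnadj ?_
    exact (induce_spanningCoe_adj.1 h).2.2
  have hmem : ∀ i ≤ p.length, p.getVert i ∈ C ∪ {x, y} := by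
    intro i hi
    rcases Nat.lt_or_ge i p.length with h | h
    · exact (induce_spanningCoe_adj.1 (p.adj_getVert_succ h)).1
    · have : i = p.length := by omega
      rw [this, p.getVert_length]
      simp
  have hinj : ∀ i ≤ p.length, ∀ j ≤ p.length, p.getVert i = p.getVert j → i = j :=
    fun i hi j hj h => hpath.getVert_injOn hi hj h
  have hadj : ∀ i j, i < j → j ≤ p.length →
      (G.Adj (p.getVert i) (p.getVert j) ↔ j = i + 1) := by
    intro i j hij hj
    constructor
    · intro h
      have h' : H.Adj (p.getVert i) (p.getVert j) :=
        induce_spanningCoe_adj.2 ⟨hmem _ (by omega), hmem _ hj, h⟩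
      have := dist_le ((p.take i).append (Walk.cons h' (p.drop j)))
      simp only [Walk.length_append, Walk.take_length, Walk.length_cons, Walk.drop_length] at this
      omega
    · rintro rfl
      exact (induce_spanningCoe_adj.1 (p.adj_getVert_succ (by omega))).2.2
  have hv : ∀ i ≤ p.length, (G.Adj (p.getVert i) v ↔ i = 0 ∨ i = p.length) := by
    intro i hi
    constructor
    · intro h
      rcases hmem i hi with h1 | h1 | h1
      · exact absurd h.symm (hC _ h1).2
      · left
        exact hinj i hi 0 (by omega) (by rw [h1, p.getVert_zero])
      · right
        exact hinj i hi _ le_rfl (by rw [h1, p.getVert_length])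
    · rintro (rfl | rfl)
      · rw [p.getVert_zero]; exact hvx.symm
      · rw [p.getVert_length]; exact hvy.symm
  have hvne : ∀ i ≤ p.length, p.getVert i ≠ v := by
    intro i hi h
    rcases hmem i hi with h1 | h1 | h1
    · exact (hC _ h1).1 h
    · exact hvx.ne (by rw [← h, h1])
    · exact hvy.ne (by rw [← h, h1])
  -- the cycle runs along `p` from `x` to `y` and returns to `x` through `v`
  let f : Fin (p.length + 2) → V := fun i => if i.val ≤ p.length then p.getVert i.val else v
  have key : ∀ i j : Fin (p.length + 2), i.val < j.val →
      (f i ≠ f j ∧ (G.Adj (f i) (f j) ↔ j.val = i.val + 1 ∨ (i.val = 0 ∧ j.val = p.length + 1))) := by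
    intro i j hij
    have hj2 := j.2
    have hi : f i = p.getVert i.val := if_pos (by omega)
    by_cases hj : j.val ≤ p.length
    · have hj' : f j = p.getVert j.val := if_pos hj
      rw [hi, hj', hadj _ _ hij hj]
      refine ⟨fun h => ?_, ?_⟩
      · have := hinj _ (by omega) _ hj h
        omega
      · omega
    · have hj' : f j = v := if_neg hj
      rw [hi, hj', hv _ (by omega)]
      refine ⟨hvne _ (by omega), ?_⟩
      omega
  refine (hG (p.length + 2) (by omega)).false ⟨⟨f, ?_⟩, ?_⟩
  · intro i j h
    rcases lt_trichotomy i.val j.val with h1 | h1 | h1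
    · exact absurd h (key i j h1).1
    · exact Fin.ext h1
    · exact absurd h.symm (key j i h1).1
  · intro i j
    change G.Adj (f i) (f j) ↔ _
    rw [cycleGraph_adj', val_sub_eq_one_iff (by omega), val_sub_eq_one_iff (by omega)]
    have hi2 := i.2
    have hj2 := j.2
    rcases lt_trichotomy i.val j.val with h1 | h1 | h1
    · rw [(key i j h1).2]; omega
    · have : i = j := Fin.ext h1
      subst this
      simp only [SimpleGraph.irrefl, false_iff]
      omega
    · rw [G.adj_comm, (key j i h1).2]; omega

/-- Dirac's lemma, in the form used below: if `K` is a clique properly contained in `W`, then the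
subgraph of a chordal graph induced by `W` has a simplicial vertex outside `K`. -/
theorem IsChordal.exists_simplicial {V : Type u} [Finite V] {G : SimpleGraph V}
    (hG : IsChordal G) (W K : Set V) (hK : G.IsClique K) (hKW : K ⊂ W) :
    ∃ u ∈ W \ K, G.IsClique {a | a ∈ W ∧ G.Adj u a} := by
  induction hn : W.ncard using Nat.strong_induction_on generalizing W K with
  | _ n ih =>
  subst hn
  -- If some `v ∈ K` misses a vertex `w` of `W`, pass to the component of `w` in `W \ N[v]` and
  -- its boundary, which is a clique.
  have main : ∀ K' : Set V, G.IsClique K' → K' ⊆ W → ∀ v ∈ K', ∀ w ∈ W, w ≠ v → ¬ G.Adj v w →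
      ∃ u ∈ W \ K', G.IsClique {a | a ∈ W ∧ G.Adj u a} := by
    intro K' hK' hKW' v hv w hw hwv hvw
    let B : Set V := {a | a ∈ W ∧ a ≠ v ∧ ¬ G.Adj v a}
    let H := (G.induce B).spanningCoe
    let C : Set V := {a | H.Reachable w a}
    let N : Set V := {x | x ∈ W ∧ G.Adj v x ∧ ∃ c ∈ C, G.Adj x c}
    have hCB : ∀ a ∈ C, a ∈ B := by
      intro a ha
      rcases ((reachable_iff_reflTransGen _ _).1 ha).cases_tail with h | ⟨c, _, h⟩
      · subst h; exact ⟨hw, hwv, hvw⟩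
      · exact (induce_spanningCoe_adj.1 h).2.1
    have hconn : ∀ a ∈ C, ∀ s : Set V, C ⊆ s → (G.induce s).spanningCoe.Reachable w a := by
      intro a ha s hs
      have ha' := (reachable_iff_reflTransGen _ _).1 ha
      induction ha' with
      | refl => exact Reachable.refl _
      | @tail b c hb hbc ih2 =>
        have hbC : b ∈ C := (reachable_iff_reflTransGen _ _).2 hb
        exact (ih2 hbC).trans (Adj.reachable (induce_spanningCoe_adj.2
          ⟨hs hbC, hs ha, (induce_spanningCoe_adj.1 hbc).2.2⟩))
    have hN : G.IsClique N := by
      rintro x ⟨hxW, hvx, c, hc, hxc⟩ y ⟨hyW, hvy, d, hd, hyd⟩ hxy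
      refine hG.adj_of_reachable (C := C) (fun c hc => (hCB c hc).2) hvx hvy hxy ?_
      have h1 := hconn c hc (C ∪ {x, y}) Set.subset_union_left
      have h2 := hconn d hd (C ∪ {x, y}) Set.subset_union_left
      have hxc' : (G.induce (C ∪ {x, y})).spanningCoe.Adj x c :=
        induce_spanningCoe_adj.2 ⟨by simp, Or.inl hc, hxc⟩
      have hyd' : (G.induce (C ∪ {x, y})).spanningCoe.Adj y d :=
        induce_spanningCoe_adj.2 ⟨by simp, Or.inl hd, hyd⟩
      exact hxc'.reachable.trans (h1.symm.trans (h2.trans hyd'.symm.reachable))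
    have hwC : w ∈ C := Reachable.refl _
    have hsub : C ∪ N ⊂ W := by
      refine ⟨Set.union_subset (fun a ha => (hCB a ha).1) (fun a ha => ha.1), fun h => ?_⟩
      rcases h (hKW' hv) with h | h
      · exact (hCB v h).2.1 rfl
      · exact h.2.1.ne rfl
    obtain ⟨u, ⟨huW, huN⟩, hu⟩ := ih _ (Set.ncard_lt_ncard hsub) (C ∪ N) N hN
      ⟨Set.subset_union_right, fun h => (hCB w hwC).2.2 (h (Or.inl hwC)).2.1⟩ rfl
    have huC : u ∈ C := huW.resolve_right huN
    have huB := hCB u huC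
    refine ⟨u, ⟨huB.1, fun h => huB.2.2 (hK' hv h huB.2.1.symm)⟩, hu.subset ?_⟩
    rintro a ⟨haW, hua⟩
    refine ⟨?_, hua⟩
    by_cases hva : G.Adj v a
    · exact Or.inr ⟨haW, hva, u, huC, hua.symm⟩
    · refine Or.inl (Reachable.trans huC (Adj.reachable (induce_spanningCoe_adj.2
        ⟨huB, ⟨haW, ?_, hva⟩, hua⟩)))
      rintro rfl
      exact huB.2.2 hua.symm
  by_cases h1 : ∃ v ∈ K, ∃ w ∈ W, w ≠ v ∧ ¬ G.Adj v w
  · obtain ⟨v, hv, w, hw, hwv, hvw⟩ := h1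
    exact main K hK hKW.1 v hv w hw hwv hvw
  push Not at h1
  -- Otherwise add to `K` a vertex that misses a vertex of `W`; if there is none, `W` is a clique.
  by_cases h2 : ∃ v ∈ W \ K, ∃ w ∈ W, w ≠ v ∧ ¬ G.Adj v w
  · obtain ⟨v, hv, w, hw, hwv, hvw⟩ := h2
    obtain ⟨u, hu, hu'⟩ := main (insert v K)
      (hK.insert fun b hb hbv => (h1 b hb v hv.1 hbv).symm)
      (Set.insert_subset hv.1 hKW.1) v (Set.mem_insert _ _) w hw hwv hvw
    exact ⟨u, ⟨hu.1, fun h => hu.2 (Set.mem_insert_of_mem _ h)⟩, hu'⟩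
  push Not at h2
  obtain ⟨u, hu, huK⟩ := Set.exists_of_ssubset hKW
  refine ⟨u, ⟨hu, huK⟩, ?_⟩
  rintro a ⟨ha, -⟩ b ⟨hb, -⟩ hab
  by_cases haK : a ∈ K
  · exact h1 a haK b hb hab.symm
  · exact h2 a ⟨ha, haK⟩ b hb hab.symm

/-! ### Orientations of a chordal graph that begin with a given clique -/

/-- `S` is closed under predecessors in `D`. -/
def IsInitial {V : Type u} (D : Digraph V) (S : Set V) : Prop :=
  ∀ ⦃x s⦄, s ∈ S → D.Adj x s → x ∈ S

/-- A chordal graph has an elimination ordering, written backwards as an injective rank function,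
in which the vertices of a prescribed clique come first: the earlier neighbours of each vertex
form a clique. -/
theorem IsChordal.exists_rank {V : Type u} [Finite V] {G : SimpleGraph V} (hG : IsChordal G)
    {K : Set V} (hK : G.IsClique K) :
    ∃ f : V → ℕ, Function.Injective f ∧ (∀ a ∈ K, ∀ b ∉ K, f a < f b) ∧
      ∀ b, G.IsClique {a | G.Adj b a ∧ f a < f b} := by
  have main : ∀ n, ∀ W : Set V, K ⊆ W → W.ncard = n → ∃ f : V → ℕ, Set.InjOn f W ∧
      (∀ a ∈ K, ∀ b ∈ W, b ∉ K → f a < f b) ∧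
      ∀ b ∈ W, G.IsClique {a | a ∈ W ∧ G.Adj b a ∧ f a < f b} := by
    intro n
    induction n with
    | zero =>
      intro W hKW hW
      have : W = ∅ := (Set.ncard_eq_zero).1 hW
      subst this
      exact ⟨fun _ => 0, by simp, by simp, by simp⟩
    | succ n ih =>
      intro W hKW hW
      by_cases hKW' : K = W
      · obtain ⟨f, hf⟩ := Countable.exists_injective_nat V
        refine ⟨f, hf.injOn, fun a _ b hb hb' => absurd (hKW' ▸ hb) hb', fun b _ => ?_⟩
        exact hK.subset fun a ha => hKW' ▸ ha.1
      · obtain ⟨u, ⟨huW, huK⟩, hu⟩ := hG.exists_simplicial W K hK (hKW.ssubset_of_ne hKW')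
        have hKu : K ⊆ W \ {u} := fun a ha => ⟨hKW ha, fun h => huK (h ▸ ha)⟩
        obtain ⟨f, hf, hfK, hfc⟩ := ih (W \ {u}) hKu
          (by rw [Set.ncard_sdiff_singleton_of_mem huW, hW]; rfl)
        obtain ⟨M, hM⟩ := (Set.finite_range f).bddAbove
        have hM' : ∀ a, f a < M + 1 := fun a => Nat.lt_succ_of_le (hM ⟨a, rfl⟩)
        classical
        have hne : ∀ a, a ≠ u → Function.update f u (M + 1) a = f a :=
          fun a ha => Function.update_of_ne ha _ _
        have hu1 : Function.update f u (M + 1) u = M + 1 := Function.update_self ..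
        refine ⟨Function.update f u (M + 1), ?_, ?_, ?_⟩
        · intro a ha b hb h
          by_cases hau : a = u <;> by_cases hbu : b = u
          · rw [hau, hbu]
          · rw [hau, hu1, hne b hbu] at h
            exact absurd h (hM' b).ne'
          · rw [hbu, hu1, hne a hau] at h
            exact absurd h (hM' a).ne
          · rw [hne a hau, hne b hbu] at h
            exact hf ⟨ha, hau⟩ ⟨hb, hbu⟩ h
        · intro a ha b hb hbK
          rw [hne a fun h => huK (h ▸ ha)]
          by_cases hbu : b = u
          · rw [hbu, hu1]; exact hM' a
          · rw [hne b hbu]; exact hfK a ha b ⟨hb, hbu⟩ hbK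
        · intro b hb
          by_cases hbu : b = u
          · subst hbu
            refine hu.subset ?_
            exact fun a ha => ⟨ha.1, ha.2.1⟩
          · refine (hfc b ⟨hb, hbu⟩).subset ?_
            rintro a ⟨haW, hba, hlt⟩
            rw [hne b hbu] at hlt
            by_cases hau : a = u
            · rw [hau, hu1] at hlt
              exact absurd (hlt.trans (hM' b)) (lt_irrefl _)
            · rw [hne a hau] at hlt
              exact ⟨⟨haW, hau⟩, hba, hlt⟩
  obtain ⟨f, h1, h2, h3⟩ := main _ Set.univ (Set.subset_univ _) rfl
  refine ⟨f, Set.injOn_univ.1 h1, fun a ha b hb => h2 a ha b trivial hb, fun b => ?_⟩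
  refine (h3 b trivial).subset ?_
  exact fun a ha => ⟨trivial, ha⟩

theorem IsOrientation.ne {V : Type u} {G : SimpleGraph V} {D : Digraph V} (h : IsOrientation G D)
    {a b : V} (hab : D.Adj a b) : a ≠ b := (h.1 _ _ hab).ne

theorem IsOrientation.not_adj {V : Type u} {G : SimpleGraph V} {D : Digraph V}
    (h : IsOrientation G D) {a b : V} (hab : D.Adj a b) : ¬ D.Adj b a := by
  intro hba
  rcases h.2 a b (h.1 _ _ hab) with h' | h'
  · exact h'.2 hba
  · exact h'.2 hab

theorem IsOrientation.adj_or {V : Type u} {G : SimpleGraph V} {D : Digraph V}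
    (h : IsOrientation G D) {a b : V} (hab : G.Adj a b) : D.Adj a b ∨ D.Adj b a :=
  (h.2 a b hab).or

theorem isOrientation_iff {V : Type u} {G : SimpleGraph V} {D : Digraph V} :
    IsOrientation G D ↔ (∀ u v, D.Adj u v → G.Adj u v ∧ ¬ D.Adj v u) ∧
      ∀ u v, G.Adj u v → D.Adj u v ∨ D.Adj v u := by
  constructor
  · exact fun h => ⟨fun u v huv => ⟨h.1 _ _ huv, h.not_adj huv⟩, fun u v => h.adj_or⟩
  · refine fun h => ⟨fun u v huv => (h.1 _ _ huv).1, fun u v huv => ?_⟩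
    rcases h.2 u v huv with h' | h'
    · exact Or.inl ⟨h', (h.1 _ _ h').2⟩
    · exact Or.inr ⟨h', (h.1 _ _ h').2⟩

/-- Two parents of a vertex in an AMO are adjacent. -/
theorem IsAMO.adj_of_adj {V : Type u} {G : SimpleGraph V} {D : Digraph V} (h : IsAMO G D)
    {a b c : V} (hab : D.Adj a b) (hcb : D.Adj c b) (hac : a ≠ c) : G.Adj a c := by
  by_contra hn
  exact h.moral a b c ⟨hac, ⟨hab, h.orientation.not_adj hab⟩, ⟨hcb, h.orientation.not_adj hcb⟩,
    fun h' => hn (h.orientation.1 _ _ h'), fun h' => hn (h.orientation.1 _ _ h').symm⟩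

/-- A criterion for AMOs in which adjacency of the parents of a vertex is only required in the
underlying graph. -/
theorem isAMO_of {V : Type u} {G : SimpleGraph V} {D : Digraph V}
    (h1 : ∀ u v, D.Adj u v → G.Adj u v) (h2 : ∀ u v, G.Adj u v → D.Adj u v ∨ D.Adj v u)
    (h3 : IsAcyclic D)
    (h4 : ∀ a b c, D.Adj a b → D.Adj c b → a ≠ c → G.Adj a c) : IsAMO G D where
  orientation := isOrientation_iff.2
    ⟨fun u v h => ⟨h1 u v h, fun h' => h3 u ((Relation.TransGen.single h).tail h')⟩, h2⟩
  acyclic := h3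
  moral := by
    rintro a b c ⟨hac, ⟨hab, -⟩, ⟨hcb, -⟩, h5, h6⟩
    rcases h2 a c (h4 a b c hab hcb hac) with h | h
    · exact h5 h
    · exact h6 h

theorem isAcyclic_of_rank {V : Type u} {D : Digraph V} (f : V → ℕ)
    (hf : ∀ a b, D.Adj a b → f a < f b) : IsAcyclic D := by
  intro v hv
  have : ∀ b, Relation.TransGen D.Adj v b → f v < f b := by
    intro b hb
    induction hb with
    | single h => exact hf _ _ h
    | tail _ h ih => exact ih.trans (hf _ _ h)
  exact lt_irrefl _ (this v hv)

/-- The ancestors of a vertex in an AMO form a chain. -/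
theorem IsAMO.reflTransGen_or {V : Type u} [Finite V] {G : SimpleGraph V} {D : Digraph V}
    (hD : IsAMO G D) {c d y : V}
    (hc : Relation.ReflTransGen D.Adj c y) (hd : Relation.ReflTransGen D.Adj d y) :
    Relation.ReflTransGen D.Adj c d ∨ Relation.ReflTransGen D.Adj d c := by
  have hwf : WellFounded (Relation.TransGen D.Adj) := by
    have : Std.Irrefl (Relation.TransGen D.Adj) := ⟨hD.acyclic⟩
    exact Finite.wellFounded_of_trans_of_irrefl _
  induction y using hwf.induction generalizing c d with
  | _ y ih =>
    rcases hc.cases_tail with rfl | ⟨a, hca, hay⟩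
    · exact Or.inr hd
    rcases hd.cases_tail with rfl | ⟨b, hdb, hby⟩
    · exact Or.inl hc
    by_cases hab : a = b
    · subst hab
      exact ih a (.single hay) hca hdb
    rcases hD.orientation.adj_or (hD.adj_of_adj hay hby hab) with h | h
    · exact ih b (.single hby) (hca.tail h) hdb
    · exact ih a (.single hay) hca (hdb.tail h)

theorem IsChordal.exists_isAMO {V : Type u} [Finite V] {G : SimpleGraph V} (hG : IsChordal G)
    {K : Set V} (hK : G.IsClique K) : ∃ D, IsAMO G D ∧ IsInitial D K := by
  obtain ⟨f, hf, hfK, hfc⟩ := hG.exists_rank hK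
  refine ⟨⟨fun a b => G.Adj a b ∧ f a < f b⟩, isAMO_of (fun u v h => h.1) ?_
    (isAcyclic_of_rank f fun a b h => h.2) ?_, ?_⟩
  · intro a b h
    rcases lt_or_gt_of_ne (hf.ne h.ne) with h' | h'
    · exact Or.inl ⟨h, h'⟩
    · exact Or.inr ⟨h.symm, h'⟩
  · rintro a b c ⟨hab, hab'⟩ ⟨hcb, hcb'⟩ hac
    exact hfc b ⟨hab.symm, hab'⟩ ⟨hcb.symm, hcb'⟩ hac
  · rintro x s hs ⟨_, h⟩
    by_contra hx
    exact absurd (h.trans (hfK s hs x hx)) (lt_irrefl _)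

/-! ### Existence of clique trees -/

/-- The maximal cliques after adding a simplicial vertex `u` with neighbourhood `N`. -/
theorem maximal_isClique_insert_iff {V : Type u} {G : SimpleGraph V} {W : Set V} {u : V}
    (hu : u ∉ W) (hN : G.IsClique {a | a ∈ W ∧ G.Adj u a}) (M : Set V) :
    Maximal (fun M => G.IsClique M ∧ M ⊆ insert u W) M ↔
      M = insert u {a | a ∈ W ∧ G.Adj u a} ∨
        (Maximal (fun M => G.IsClique M ∧ M ⊆ W) M ∧ M ≠ {a | a ∈ W ∧ G.Adj u a}) := by
  set N := {a | a ∈ W ∧ G.Adj u a} with hNdef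
  have huN : u ∉ N := fun h => hu h.1
  have hsub : ∀ M, G.IsClique M → M ⊆ insert u W → u ∈ M → M ⊆ insert u N := by
    intro M hM hMW huM a ha
    by_cases hau : a = u
    · exact Or.inl hau
    · exact Or.inr ⟨(hMW ha).resolve_left hau, hM huM ha (Ne.symm hau)⟩
  have hcl : G.IsClique (insert u N) := hN.insert fun b hb _ => hb.2
  have hclW : insert u N ⊆ insert u W := Set.insert_subset_insert fun a ha => ha.1
  constructor
  · intro hM
    by_cases huM : u ∈ M
    · exact Or.inl (hM.eq_of_subset ⟨hcl, hclW⟩ (hsub M hM.prop.1 hM.prop.2 huM)).symm.symm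
    · have hMW : M ⊆ W := fun a ha => (hM.prop.2 ha).resolve_left fun h => huM (h ▸ ha)
      refine Or.inr ⟨⟨⟨hM.prop.1, hMW⟩, fun M' hM' h => hM.2
        ⟨hM'.1, hM'.2.trans (Set.subset_insert _ _)⟩ h⟩, ?_⟩
      rintro rfl
      exact huM (hM.2 ⟨hcl, hclW⟩ (Set.subset_insert _ _) (Set.mem_insert _ _))
  · rintro (rfl | ⟨hM, hMN⟩)
    · exact ⟨⟨hcl, hclW⟩, fun M' hM' h => hsub M' hM'.1 hM'.2 (h (Set.mem_insert _ _))⟩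
    · refine ⟨⟨hM.prop.1, hM.prop.2.trans (Set.subset_insert _ _)⟩, fun M' hM' h => ?_⟩
      by_cases huM : u ∈ M'
      · exfalso
        refine hMN (hM.eq_of_subset ⟨hN, fun a ha => ha.1⟩ ?_)
        intro a ha
        exact (hsub M' hM'.1 hM'.2 huM (h ha)).resolve_left fun hau => hu (hau ▸ hM.prop.2 ha)
      · exact hM.2 ⟨hM'.1, fun a ha => (hM'.2 ha).resolve_left fun hau => huM (hau ▸ ha)⟩ h

/-- The maximal cliques of a chordal graph can be listed as `B 0, …, B n` with the running
intersection property: `p i < i`, and `B i` meets the earlier cliques only inside `B (p i)`. -/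
theorem IsChordal.exists_running_intersection {V : Type u} [Finite V] {G : SimpleGraph V}
    (hG : IsChordal G) :
    ∃ (n : ℕ) (B : ℕ → Set V) (p : ℕ → ℕ), Set.InjOn B (Set.Iic n) ∧
      (∀ M, (∃ i ≤ n, B i = M) ↔ M ∈ maxCliques G) ∧
      ∀ i ≤ n, 0 < i → p i < i ∧ ∀ j < i, B i ∩ B j ⊆ B (p i) := by
  have main : ∀ m, ∀ W : Set V, W.ncard = m → ∃ (n : ℕ) (B : ℕ → Set V) (p : ℕ → ℕ),
      Set.InjOn B (Set.Iic n) ∧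
      (∀ M, (∃ i ≤ n, B i = M) ↔ Maximal (fun M => G.IsClique M ∧ M ⊆ W) M) ∧
      ∀ i ≤ n, 0 < i → p i < i ∧ ∀ j < i, B i ∩ B j ⊆ B (p i) := by
    intro m
    induction m with
    | zero =>
      intro W hW
      obtain rfl : W = ∅ := (Set.ncard_eq_zero).1 hW
      refine ⟨0, fun _ => ∅, fun _ => 0, ?_, fun M => ?_, by omega⟩
      · intro i hi j hj _
        rw [Nat.le_zero.1 hi, Nat.le_zero.1 hj]
      · constructor
        · rintro ⟨_, _, rfl⟩
          exact ⟨⟨by simp, le_rfl⟩, fun M' hM' _ => hM'.2⟩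
        · intro h
          exact ⟨0, le_rfl, (Set.subset_empty_iff.1 h.prop.2).symm⟩
    | succ m ih =>
      intro W' hW'
      have hne : W'.Nonempty := Set.nonempty_of_ncard_ne_zero (by omega)
      obtain ⟨u, ⟨huW, -⟩, hu⟩ := hG.exists_simplicial W' ∅ (by simp)
        (Set.empty_ssubset.2 hne)
      obtain ⟨W, huW', rfl⟩ : ∃ W, u ∉ W ∧ insert u W = W' :=
        ⟨W' \ {u}, by simp, by simp [Set.insert_eq_of_mem huW]⟩
      have hN : G.IsClique {a | a ∈ W ∧ G.Adj u a} := by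
        refine hu.subset ?_
        exact fun a ha => ⟨Or.inr ha.1, ha.2⟩
      obtain ⟨n, B, p, hinj, hB, hp⟩ := ih W (by
        rw [Set.ncard_insert_of_notMem huW'] at hW'; omega)
      have hmax := maximal_isClique_insert_iff huW' hN
      set N := {a | a ∈ W ∧ G.Adj u a} with hNdef
      have huB : ∀ i ≤ n, u ∉ B i := fun i hi h => huW' (((hB _).1 ⟨i, hi, rfl⟩).prop.2 h)
      by_cases hNmax : ∃ j ≤ n, B j = N
      · -- The clique `N` stops being maximal and is replaced by `N ∪ {u}`.
        obtain ⟨j, hj, hjN⟩ := hNmax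
        have hself : Function.update B j (insert u N) j = insert u N := Function.update_self ..
        have hother : ∀ i, i ≠ j → Function.update B j (insert u N) i = B i :=
          fun i hi => Function.update_of_ne hi _ _
        have hmono : ∀ i, B i ⊆ Function.update B j (insert u N) i := by
          intro i
          by_cases hij : i = j
          · rw [hij, hself, hjN]; exact Set.subset_insert _ _
          · rw [hother i hij]
        refine ⟨n, Function.update B j (insert u N), p, ?_, fun M => ?_, ?_⟩
        · intro a ha b hb hab
          by_cases h1 : a = j <;> by_cases h2 : b = j
          · rw [h1, h2]
          · rw [h1, hself, hother b h2] at hab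
            exact absurd (hab ▸ Set.mem_insert u N) (huB b hb)
          · rw [h2, hself, hother a h1] at hab
            exact absurd (hab ▸ Set.mem_insert u N) (huB a ha)
          · rw [hother a h1, hother b h2] at hab
            exact hinj ha hb hab
        · rw [hmax, ← hB]
          constructor
          · rintro ⟨i, hi, rfl⟩
            by_cases hij : i = j
            · left; rw [hij, hself]
            · right
              rw [hother i hij]
              refine ⟨⟨i, hi, rfl⟩, fun h => hij (hinj hi hj (h.trans hjN.symm))⟩
          · rintro (rfl | ⟨⟨i, hi, rfl⟩, h⟩)
            · exact ⟨j, hj, hself⟩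
            · exact ⟨i, hi, hother i fun hij => h (hij ▸ hjN)⟩
        · intro i hi hi0
          refine ⟨(hp i hi hi0).1, fun k hk a ha => ?_⟩
          refine hmono _ ((hp i hi hi0).2 k hk ?_)
          by_cases hau : a = u
          · -- `u` lies in one bag only
            exfalso
            subst hau
            by_cases h1 : i = j
            · rw [hother k (by omega)] at ha
              exact huB k (by omega) ha.2
            · rw [hother i h1] at ha
              exact huB i hi ha.1
          · have hback : ∀ i, a ∈ Function.update B j (insert u N) i → a ∈ B i := by
              intro i h
              by_cases hij : i = j
              · rw [hij, hself] at h
                rw [hij, hjN]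
                exact h.resolve_left hau
              · rwa [hother i hij] at h
            exact ⟨hback _ ha.1, hback _ ha.2⟩
      · -- A new node with bag `N ∪ {u}` is attached to a node whose bag contains `N`.
        obtain ⟨M, hNM, hM⟩ := (Set.toFinite {M : Set V | G.IsClique M ∧ M ⊆ W}).exists_le_maximal
          (a := N) ⟨hN, fun a ha => ha.1⟩
        obtain ⟨j, hj, rfl⟩ := (hB M).2 hM
        have hself : Function.update B (n + 1) (insert u N) (n + 1) = insert u N :=
          Function.update_self ..
        have hother : ∀ i, i ≤ n → Function.update B (n + 1) (insert u N) i = B i :=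
          fun i hi => Function.update_of_ne (by omega) _ _
        refine ⟨n + 1, Function.update B (n + 1) (insert u N), Function.update p (n + 1) j,
          ?_, fun M => ?_, ?_⟩
        · intro a ha b hb hab
          rcases Nat.le_succ_iff.1 ha with h1 | h1 <;> rcases Nat.le_succ_iff.1 hb with h2 | h2
          · rw [hother a h1, hother b h2] at hab
            exact hinj h1 h2 hab
          · rw [h2, hself, hother a h1] at hab
            exact absurd (hab ▸ Set.mem_insert u N) (huB a h1)
          · rw [h1, hself, hother b h2] at hab
            exact absurd (hab ▸ Set.mem_insert u N) (huB b h2)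
          · rw [h1, h2]
        · rw [hmax, ← hB]
          constructor
          · rintro ⟨i, hi, rfl⟩
            rcases Nat.le_succ_iff.1 hi with h1 | h1
            · right
              rw [hother i h1]
              exact ⟨⟨i, h1, rfl⟩, fun h => hNmax ⟨i, h1, h⟩⟩
            · left; rw [h1, hself]
          · rintro (rfl | ⟨⟨i, hi, rfl⟩, h⟩)
            · exact ⟨n + 1, le_rfl, hself⟩
            · exact ⟨i, by omega, hother i hi⟩
        · intro i hi hi0
          rcases Nat.le_succ_iff.1 hi with h1 | h1
          · have hpi : Function.update p (n + 1) j i = p i := Function.update_of_ne (by omega) _ _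
            have hp' := hp i h1 hi0
            rw [hpi, hother i h1, hother (p i) (by omega)]
            refine ⟨hp'.1, fun k hk => ?_⟩
            rw [hother k (by omega)]
            exact hp'.2 k hk
          · subst h1
            rw [Function.update_self, hself, hother j hj]
            refine ⟨by omega, fun k hk => ?_⟩
            rw [hother k (by omega)]
            rintro a ⟨rfl | ha, ha'⟩
            · exact absurd ha' (huB k (by omega))
            · exact hNM ha
  obtain ⟨n, B, p, h1, h2, h3⟩ := main _ Set.univ rfl
  exact ⟨n, B, p, h1, fun M => by rw [h2]; simp [maxCliques], h3⟩

/-- A set of nodes that is closed under taking parents, except at a node `m` where the chains of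
parents end, induces a connected subgraph. -/
theorem connected_induce_of_parent {N : Type w} {T : SimpleGraph N} (par : N → N) (rank : N → ℕ)
    {S : Set N} {m : N} (hm : m ∈ S)
    (h : ∀ x ∈ S, x ≠ m → T.Adj x (par x) ∧ par x ∈ S ∧ rank (par x) < rank x) :
    (T.induce S).Connected := by
  have main : ∀ k, ∀ x : S, rank x = k → (T.induce S).Reachable x ⟨m, hm⟩ := by
    intro k
    induction k using Nat.strong_induction_on with
    | _ k ih =>
      rintro ⟨x, hx⟩ hk
      by_cases hxm : x = m
      · subst hxm; exact Reachable.refl _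
      · obtain ⟨h1, h2, h3⟩ := h x hx hxm
        have hadj : (T.induce S).Adj ⟨x, hx⟩ ⟨par x, h2⟩ := h1
        exact hadj.reachable.trans (ih _ (hk ▸ h3) ⟨par x, h2⟩ rfl)
  exact { preconnected := fun x y => (main _ x rfl).trans (main _ y rfl).symm
          nonempty := ⟨⟨m, hm⟩⟩ }

theorem isTree_of_parent {N : Type w} [Finite N] {T : SimpleGraph N} (root : N) (par : N → N)
    (rank : N → ℕ) (hrank : ∀ x ≠ root, rank (par x) < rank x)
    (hT : ∀ x y, T.Adj x y ↔ (x ≠ root ∧ y = par x) ∨ (y ≠ root ∧ x = par y)) : T.IsTree := by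
  have hconn : T.Connected := by
    have := connected_induce_of_parent (T := T) par rank (S := Set.univ) (m := root) trivial
      (fun x _ hx => ⟨(hT _ _).2 (Or.inl ⟨hx, rfl⟩), trivial, hrank x hx⟩)
    exact (Iso.connected_iff (induceUnivIso T)).1 this
  -- every edge joins a node other than the root to its parent, so there are few enough edges
  rw [isTree_iff_connected_and_card]
  refine ⟨hconn, le_antisymm ?_ hconn.card_vert_le_card_edgeSet_add_one⟩
  have hsub : T.edgeSet ⊆ (fun x => s(x, par x)) '' ({root}ᶜ : Set N) := by
    intro e he
    induction e using Sym2.ind with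
    | _ x y =>
      rcases (hT x y).1 he with ⟨h1, rfl⟩ | ⟨h1, rfl⟩
      · exact ⟨x, h1, rfl⟩
      · exact ⟨y, h1, Sym2.eq_swap⟩
  have h1 : T.edgeSet.ncard ≤ ({root}ᶜ : Set N).ncard :=
    (Set.ncard_le_ncard hsub).trans (Set.ncard_image_le (Set.toFinite _))
  have h2 := Set.ncard_add_ncard_compl ({root} : Set N)
  rw [Set.ncard_singleton] at h2
  change T.edgeSet.ncard + 1 ≤ _
  omega

theorem IsChordal.nonempty_rootedCliqueTree {V : Type u} [Finite V] {G : SimpleGraph V}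
    (hG : IsChordal G) : Nonempty (RootedCliqueTree.{u, w} G) := by
  obtain ⟨n, B, p, hinj, hB, hp⟩ := hG.exists_running_intersection
  let N := ULift.{w} (Fin (n + 1))
  let root : N := ⟨0⟩
  let par : N → N := fun x => ⟨Fin.ofNat (n + 1) (p x.down.val)⟩
  let rank : N → ℕ := fun x => x.down.val
  have hne0 : ∀ x : N, x ≠ root → 0 < rank x := by
    intro x hx
    refine Nat.pos_of_ne_zero fun h => hx ?_
    exact ULift.ext _ _ (Fin.ext h)
  have hle : ∀ x : N, rank x ≤ n := fun x => Nat.lt_succ_iff.1 x.down.2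
  have hpar : ∀ x : N, x ≠ root → rank (par x) = p (rank x) := by
    intro x hx
    refine Nat.mod_eq_of_lt ?_
    have := (hp (rank x) (hle x) (hne0 x hx)).1
    have := hle x
    change p (rank x) < n + 1
    omega
  have hrank : ∀ x : N, x ≠ root → rank (par x) < rank x := by
    intro x hx
    rw [hpar x hx]
    exact (hp (rank x) (hle x) (hne0 x hx)).1
  let T : SimpleGraph N :=
    { Adj := fun x y => (x ≠ root ∧ y = par x) ∨ (y ≠ root ∧ x = par y)
      symm := ⟨fun x y h => h.symm⟩
      loopless := ⟨by
        rintro x (⟨h1, h2⟩ | ⟨h1, h2⟩) <;>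
        · have := hrank x h1
          rw [← h2] at this
          exact lt_irrefl _ this⟩ }
  refine ⟨⟨N, T, isTree_of_parent root par rank hrank fun x y => Iff.rfl, root,
    fun x => B (rank x), ⟨?_, ?_, ?_⟩, ?_⟩⟩
  · exact fun x _ => (hB _).1 ⟨rank x, hle x, rfl⟩
  · intro x _ y _ h
    exact ULift.ext _ _ (Fin.ext (hinj (hle x) (hle y) h))
  · intro M hM
    obtain ⟨i, hi, rfl⟩ := (hB M).2 hM
    exact ⟨⟨⟨i, by omega⟩⟩, trivial, rfl⟩
  · intro v
    obtain ⟨M, hvM, hM⟩ := (Set.toFinite {M : Set V | G.IsClique M}).exists_le_maximal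
      (a := {v}) (by simp)
    obtain ⟨i, hi, rfl⟩ := (hB M).2 hM
    -- the first bag containing `v` is the top of the subtree of `v`
    have hex : ∃ i, i ≤ n ∧ v ∈ B i := ⟨i, hi, hvM rfl⟩
    classical
    have hm := Nat.find_spec hex
    refine connected_induce_of_parent par rank (m := ⟨⟨Nat.find hex, by omega⟩⟩) hm.2 ?_
    intro x hx hxm
    have hxv : v ∈ B (rank x) := hx
    have hlt : Nat.find hex < rank x := by
      refine lt_of_le_of_ne (Nat.find_min' hex ⟨hle x, hxv⟩) fun h => hxm ?_
      exact ULift.ext _ _ (Fin.ext h.symm)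
    have hxr : x ≠ root := by
      rintro rfl
      exact Nat.not_lt_zero _ hlt
    refine ⟨Or.inl ⟨hxr, rfl⟩, ?_, hrank x hxr⟩
    change v ∈ B (rank (par x))
    rw [hpar x hxr]
    exact (hp _ (hle x) (hne0 x hxr)).2 _ hlt ⟨hxv, hm.2⟩

/-! ### Graphs whose components are induced subgraphs -/

/-- `W` is a subgraph of `G` each of whose connected components is an induced subgraph of `G`. -/
structure IsInducedOnComponents {V : Type u} (W G : SimpleGraph V) : Prop where
  le : W ≤ G
  adj_of_reachable : ∀ ⦃a b⦄, W.Reachable a b → G.Adj a b → W.Adj a b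

/-- The part of a digraph that lies on the edges of `W`. -/
def restrict {V : Type u} (D : Digraph V) (W : SimpleGraph V) : Digraph V where
  Adj a b := D.Adj a b ∧ W.Adj a b

theorem IsAcyclic.mono {V : Type u} {D D' : Digraph V} (h : ∀ a b, D'.Adj a b → D.Adj a b)
    (hD : IsAcyclic D) : IsAcyclic D' :=
  fun v hv => hD v (Relation.TransGen.mono h _ _ hv)

theorem IsInducedOnComponents.isAMO_restrict {V : Type u} {W G : SimpleGraph V}
    (hW : IsInducedOnComponents W G) {D : Digraph V} (hD : IsAMO G D) :
    IsAMO W (restrict D W) :=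
  isAMO_of (fun _ _ h => h.2)
    (fun _ _ h => (hD.orientation.adj_or (hW.le h)).imp (fun h' => ⟨h', h⟩) fun h' => ⟨h', h.symm⟩)
    (hD.acyclic.mono fun _ _ h => h.1)
    (fun _ _ _ hab hcb hac => hW.adj_of_reachable (hab.2.reachable.trans hcb.2.symm.reachable)
      (hD.adj_of_adj hab.1 hcb.1 hac))

theorem IsInducedOnComponents.isChordal {V : Type u} {W G : SimpleGraph V}
    (hW : IsInducedOnComponents W G) (hG : IsChordal G) : IsChordal W := by
  intro n hn
  refine ⟨fun f => (hG n hn).false ⟨f.toEmbedding, fun {a b} => ?_⟩⟩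
  rw [← f.map_rel_iff']
  exact ⟨hW.adj_of_reachable ((cycleGraph_preconnected a b).map f.toHom), fun h => hW.le h⟩

theorem IsChordal.of_embedding {V : Type u} {V' : Type w} {G : SimpleGraph V}
    {G' : SimpleGraph V'} (e : G' ↪g G) (hG : IsChordal G) : IsChordal G' :=
  fun n hn => ⟨fun f => (hG n hn).false (f.trans e)⟩

/-! ### Edges whose direction is forced by an initial clique -/

/-- The edges of `G` whose direction is forced in all AMOs in which `K` is initial: those leaving
`K`, and then `x → y` whenever `z → x` is forced and `z`, `y` are not adjacent. -/
inductive Forced {V : Type u} (G : SimpleGraph V) (K : Set V) : V → V → Prop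
  | base {z x : V} : z ∈ K → x ∉ K → G.Adj z x → Forced G K z x
  | step {z x y : V} : Forced G K z x → G.Adj x y → z ≠ y → ¬ G.Adj z y → Forced G K x y

/-- The graph of the edges of `G` that are forced in neither direction. -/
def residual {V : Type u} (G : SimpleGraph V) (K : Set V) : SimpleGraph V where
  Adj a b := G.Adj a b ∧ ¬ Forced G K a b ∧ ¬ Forced G K b a
  symm := ⟨fun _ _ h => ⟨h.1.symm, h.2.2, h.2.1⟩⟩
  loopless := ⟨fun _ h => h.1.ne rfl⟩

section
variable {V : Type u} {G : SimpleGraph V} {K : Set V} {α : Digraph V}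

theorem Forced.graph_adj {z x : V} (h : Forced G K z x) : G.Adj z x := by
  cases h with
  | base _ _ h => exact h
  | step _ h _ _ => exact h

theorem Forced.adj {z x : V} (h : Forced G K z x) (hα : IsAMO G α) (hK : IsInitial α K) :
    α.Adj z x := by
  induction h with
  | base hz hx h => exact (hα.orientation.adj_or h).resolve_right fun h' => hx (hK hz h')
  | step _ h hne hn ih =>
    exact (hα.orientation.adj_or h).resolve_right fun h' => hn (hα.adj_of_adj ih h' hne)

theorem Forced.notMem {z x : V} (h : Forced G K z x) (hα : IsAMO G α) (hK : IsInitial α K) :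
    x ∉ K := by
  induction h with
  | base _ hx _ => exact hx
  | step h1 h hne hn ih => exact fun hy => ih (hK hy ((Forced.step h1 h hne hn).adj hα hK))

/-- Walking back along the chain that forces `z → x`, a common neighbour `y` of `z` and `x` is
either forced from `z`, or from an earlier vertex of the chain; the latter is not adjacent to `x`
because the chain is an induced path. -/
theorem Forced.of_adj_adj {z x : V} (h : Forced G K z x) (hα : IsAMO G α) (hK : IsInitial α K)
    {y : V} (hy : y ∉ K) (hyz : G.Adj y z) (hyx : G.Adj y x) :
    Forced G K z y ∨ ∃ w, Forced G K w y ∧ w ≠ x ∧ ¬ G.Adj w x ∧ Relation.TransGen α.Adj w z := by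
  induction h with
  | base hz hx h => exact Or.inl (.base hz hy hyz.symm)
  | @step w z x h1 h hne hn ih =>
    have hwz := h1.adj hα hK
    have hzx := (Forced.step h1 h hne hn).adj hα hK
    by_cases hwy : G.Adj w y
    · right
      rcases ih hwy.symm hyz with h2 | ⟨v, hvy, hvz, hvz', hvw⟩
      · exact ⟨w, h2, hne, hn, .single hwz⟩
      · have hvz'' := hvw.tail hwz
        have hvx := hvz''.tail hzx
        refine ⟨v, hvy, ?_, fun hadj => ?_, hvz''⟩
        · rintro rfl
          exact hα.acyclic _ hvx
        · have : α.Adj v x := (hα.orientation.adj_or hadj).resolve_right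
            fun h' => hα.acyclic _ (hvx.tail h')
          exact hvz' (hα.adj_of_adj this hzx hvz)
    · exact Or.inl (.step h1 hyz.symm (fun h => hn (h ▸ hyx)) hwy)

/-- Vertices joined by an edge that is not forced have the same forced predecessors. -/
theorem Forced.of_residual_adj {z x y : V} (h : Forced G K z x) (hα : IsAMO G α)
    (hK : IsInitial α K) (hxy : (residual G K).Adj x y) : Forced G K z y := by
  obtain ⟨hadj, h1, h2⟩ := hxy
  have hzy : G.Adj z y := by
    by_contra hn
    by_cases hzy : z = y
    · exact h2 (hzy ▸ h)
    · exact h1 (.step h hadj hzy hn)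
  have hy : y ∉ K := fun hy => h2 (.base hy (h.notMem hα hK) hadj.symm)
  rcases h.of_adj_adj hα hK hy hzy.symm hadj.symm with h3 | ⟨w, h3, h4, h5, -⟩
  · exact h3
  · exact absurd (Forced.step h3 hadj.symm h4 h5) h2

theorem Forced.of_residual_reachable {z x y : V} (h : Forced G K z x) (hα : IsAMO G α)
    (hK : IsInitial α K) (hxy : (residual G K).Reachable x y) : Forced G K z y := by
  have := (reachable_iff_reflTransGen _ _).1 hxy
  induction this with
  | refl => exact h
  | tail hb hbc ih => exact (ih ((reachable_iff_reflTransGen _ _).2 hb)).of_residual_adj hα hK hbc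

theorem isInducedOnComponents_residual (hα : IsAMO G α) (hK : IsInitial α K) :
    IsInducedOnComponents (residual G K) G where
  le _ _ h := h.1
  adj_of_reachable _ _ hab h :=
    ⟨h, fun hF => (hF.of_residual_reachable hα hK hab.symm).graph_adj.ne rfl,
      fun hF => (hF.of_residual_reachable hα hK hab).graph_adj.ne rfl⟩

/-- The forced edges together with an orientation of the other ones. -/
def glue (G : SimpleGraph V) (K : Set V) (β : Digraph V) : Digraph V where
  Adj a b := Forced G K a b ∨ β.Adj a b

/-- Every AMO of the unforced edges extends, by the forced edges, to an AMO of the whole graph. A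
directed cycle would give one of forced edges only, since the forced edges entering a component of
unforced edges enter all of its vertices; for the same reason there are no new v-structures. -/
theorem isAMO_glue (hα : IsAMO G α) (hK : IsInitial α K) {β : Digraph V}
    (hβ : IsAMO (residual G K) β) : IsAMO G (glue G K β) := by
  have hβG : ∀ a b, β.Adj a b → (residual G K).Adj a b := hβ.orientation.1
  refine isAMO_of ?_ ?_ ?_ ?_
  · rintro a b (h | h)
    · exact h.graph_adj
    · exact (hβG _ _ h).1
  · intro a b h
    by_cases h1 : Forced G K a b
    · exact Or.inl (Or.inl h1)
    by_cases h2 : Forced G K b a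
    · exact Or.inr (Or.inl h2)
    exact (hβ.orientation.adj_or ⟨h, h1, h2⟩).imp Or.inr Or.inr
  · have key : ∀ a b, Relation.TransGen (glue G K β).Adj a b →
        ((residual G K).Reachable a b ∧ Relation.TransGen β.Adj a b) ∨
        ∃ c, (residual G K).Reachable a c ∧ Relation.TransGen (Forced G K) c b := by
      intro a b hab
      induction hab with
      | @single b h =>
        rcases h with h | h
        · exact Or.inr ⟨a, Reachable.refl _, .single h⟩
        · exact Or.inl ⟨(hβG _ _ h).reachable, .single h⟩
      | @tail b d _ h ih =>
        rcases h with h | h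
        · rcases ih with ⟨h1, -⟩ | ⟨c, h1, h2⟩
          · exact Or.inr ⟨b, h1, .single h⟩
          · exact Or.inr ⟨c, h1, h2.tail h⟩
        · rcases ih with ⟨h1, h2⟩ | ⟨c, h1, h2⟩
          · exact Or.inl ⟨h1.trans (hβG _ _ h).reachable, h2.tail h⟩
          · refine Or.inr ⟨c, h1, ?_⟩
            cases h2 with
            | single h3 => exact .single (h3.of_residual_adj hα hK (hβG _ _ h))
            | tail h2 h3 => exact h2.tail (h3.of_residual_adj hα hK (hβG _ _ h))
    intro v hv
    rcases key v v hv with ⟨-, h⟩ | ⟨c, h1, h2⟩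
    · exact hβ.acyclic v h
    · have h3 : Relation.TransGen (Forced G K) c c := by
        cases h2 with
        | single h3 => exact .single (h3.of_residual_reachable hα hK h1)
        | tail h2 h3 => exact h2.tail (h3.of_residual_reachable hα hK h1)
      exact hα.acyclic c (Relation.TransGen.mono (fun _ _ h => h.adj hα hK) _ _ h3)
  · rintro a b c (hab | hab) (hcb | hcb) hac
    · exact hα.adj_of_adj (hab.adj hα hK) (hcb.adj hα hK) hac
    · exact (hab.of_residual_adj hα hK (hβG _ _ hcb).symm).graph_adj
    · exact (hcb.of_residual_adj hα hK (hβG _ _ hab).symm).graph_adj.symm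
    · exact (hβ.adj_of_adj hab hcb hac).1

theorem isInitial_glue (hα : IsAMO G α) (hK : IsInitial α K) {β : Digraph V}
    (hβ : IsAMO (residual G K) β) : IsInitial (glue G K β) K := by
  rintro x s hs (h | h)
  · exact absurd hs (h.notMem hα hK)
  · by_contra hx
    have := hβ.orientation.1 _ _ h
    exact this.2.2 (.base hs hx this.1.symm)

/-- In a chordal graph the edges that are not forced occur in both directions. -/
theorem exists_isAMO_of_residual_adj [Finite V] (hG : IsChordal G) (hα : IsAMO G α)
    (hK : IsInitial α K) {x y : V} (hxy : (residual G K).Adj x y) :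
    ∃ D, IsAMO G D ∧ IsInitial D K ∧ D.Adj x y := by
  obtain ⟨β, hβ, hx⟩ := ((isInducedOnComponents_residual hα hK).isChordal hG).exists_isAMO
    (K := {x}) (by simp)
  refine ⟨_, isAMO_glue hα hK hβ, isInitial_glue hα hK hβ, Or.inr ?_⟩
  exact (hβ.orientation.adj_or hxy).resolve_right fun h => hxy.ne (hx rfl h).symm

end

/-! ### Lists and topological orderings -/

section
variable {V : Type u}

theorem sublist_pair_or {l : List V} {a b : V} (ha : a ∈ l) (hb : b ∈ l) (hab : a ≠ b) :
    [a, b].Sublist l ∨ [b, a].Sublist l := by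
  induction l with
  | nil => simp at ha
  | cons c l ih =>
    rcases List.mem_cons.1 ha with rfl | ha'
    · exact Or.inl ((List.singleton_sublist.2
        ((List.mem_cons.1 hb).resolve_left (Ne.symm hab))).cons_cons _)
    · rcases List.mem_cons.1 hb with rfl | hb'
      · exact Or.inr ((List.singleton_sublist.2 ha').cons_cons _)
      · exact (ih ha' hb').imp (fun h => h.cons _) fun h => h.cons _

theorem sublist_pair_of_pairwise {r : V → V → Prop} {l : List V} (hl : l.Pairwise r) {a b : V}
    (ha : a ∈ l) (hb : b ∈ l) (hab : a ≠ b) (hba : ¬ r b a) : [a, b].Sublist l :=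
  (sublist_pair_or ha hb hab).resolve_right fun h => hba (List.pairwise_iff_forall_sublist.1 hl h)

theorem not_sublist_pair_swap {l : List V} (hl : l.Nodup) {a b : V} (h1 : [a, b].Sublist l) :
    ¬ [b, a].Sublist l := by
  intro h2
  induction l with
  | nil => simp at h1
  | cons c l ih =>
    have hl' := List.nodup_cons.1 hl
    cases h1 with
    | cons _ h1 =>
      cases h2 with
      | cons _ h2 => exact ih hl'.2 h1 h2
      | cons_cons _ h2 => exact hl'.1 (h1.subset (by simp))
    | cons_cons _ h1 =>
      cases h2 with
      | cons _ h2 => exact hl'.1 (h2.subset (by simp))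
      | cons_cons _ h2 => exact hl'.1 (h1.subset (by simp))

theorem mem_of_sublist_pair_of_isPrefix {π τ : List V} (hτ : τ.Nodup) (hπ : π <+: τ) {a b : V}
    (hab : [a, b].Sublist τ) (hb : b ∈ π) : a ∈ π := by
  obtain ⟨ρ, rfl⟩ := hπ
  by_contra ha
  have ha' : a ∈ ρ := (List.mem_append.1 (hab.subset (by simp))).resolve_left ha
  exact not_sublist_pair_swap hτ hab
    ((List.singleton_sublist.2 hb).append (List.singleton_sublist.2 ha'))

/-- In an acyclic digraph on a finite vertex set, an initial set can be listed first in a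
topological ordering. -/
theorem IsAcyclic.exists_isTopologicalOrdering [Finite V] {D : Digraph V} (hD : IsAcyclic D)
    {K : Set V} (hK : IsInitial D K) :
    ∃ π ρ, IsPermutationOf π K ∧ IsTopologicalOrdering D (π ++ ρ) := by
  -- sort `K`, and then the remaining vertices, by a linear extension of the ancestor relation
  have hpo : IsPartialOrder V (Relation.ReflTransGen D.Adj) :=
    { refl := fun _ => .refl
      trans := fun _ _ _ h1 h2 => h1.trans h2
      antisymm := by
        intro a b h1 h2
        rcases Relation.reflTransGen_iff_eq_or_transGen.1 h1 with h | h
        · exact h.symm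
        · exact absurd (h.trans_left h2) (hD a) }
  obtain ⟨s, hs, hle⟩ := extend_partialOrder (Relation.ReflTransGen D.Adj)
  classical
  have := Fintype.ofFinite V
  refine ⟨K.toFinset.sort s, (Kᶜ).toFinset.sort s, ⟨Finset.sort_nodup .., by simp⟩,
    ⟨?_, by simp [em]⟩, ?_⟩
  · rw [List.nodup_append]
    refine ⟨Finset.sort_nodup .., Finset.sort_nodup .., ?_⟩
    intro a ha b hb hab
    simp only [Finset.mem_sort, Set.mem_toFinset] at ha hb
    exact hb (hab ▸ ha)
  · intro a b hab
    have hne : a ≠ b := by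
      rintro rfl
      exact hD a (.single hab)
    have hsab : s a b := hle _ _ (.single hab)
    have hsba : ¬ s b a := fun h => hne (hs.antisymm _ _ hsab h)
    by_cases hb : b ∈ K
    · have ha := hK hb hab
      exact (sublist_pair_of_pairwise (Finset.pairwise_sort _ s) (by simpa using ha)
        (by simpa using hb) hne hsba).trans (List.sublist_append_left _ _)
    · by_cases ha : a ∈ K
      · exact (List.singleton_sublist.2 (by simpa using ha)).append
          (List.singleton_sublist.2 (by simpa using hb))
      · exact (sublist_pair_of_pairwise (Finset.pairwise_sort _ s) (by simpa using ha)
          (by simpa using hb) hne hsba).trans (List.sublist_append_right _ _)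

theorem cliqueOrientation_adj_iff [Finite V] {G : SimpleGraph V} {K : Set V} {x y : V} :
    (cliqueOrientation G K).Adj x y ↔ ∃ D, IsAMO G D ∧ IsInitial D K ∧ D.Adj x y := by
  constructor
  · rintro ⟨_, ⟨π, hπ, rfl⟩, D, ⟨hD, τ, hτ, hπτ⟩, hxy⟩
    refine ⟨D, hD, fun a b hb hab => (hπ.2 a).1 ?_, hxy⟩
    exact mem_of_sublist_pair_of_isPrefix hτ.1.1 hπτ (hτ.2 _ _ hab) ((hπ.2 b).2 hb)
  · rintro ⟨D, hD, hK, hxy⟩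
    obtain ⟨π, ρ, hπ, hτ⟩ := hD.acyclic.exists_isTopologicalOrdering hK
    exact ⟨_, ⟨π, hπ, rfl⟩, D, ⟨hD, _, hτ, List.prefix_append _ _⟩, hxy⟩

/-! ### The undirected components of `G^K[V \ K]` -/

/-- The undirected edges of `G^K` outside `K` are the edges that are not forced. -/
theorem undirectedRest_adj_iff [Finite V] {G : SimpleGraph V} (hG : IsChordal G) {K : Set V}
    (hK : G.IsClique K) {x y : V} :
    (undirectedRest G K).Adj x y ↔ x ∉ K ∧ y ∉ K ∧ (residual G K).Adj x y := by
  obtain ⟨α, hα, hαK⟩ := hG.exists_isAMO hK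
  rw [undirectedRest, induce_spanningCoe_adj]
  refine and_congr Iff.rfl (and_congr Iff.rfl ⟨?_, fun h => ⟨h.ne, ?_, ?_⟩⟩)
  · rintro ⟨-, h1, h2⟩
    obtain ⟨D, hD, hDK, hxy⟩ := cliqueOrientation_adj_iff.1 h1
    obtain ⟨D', hD', hDK', hyx⟩ := cliqueOrientation_adj_iff.1 h2
    exact ⟨hD.orientation.1 _ _ hxy, fun h => hD'.orientation.not_adj hyx (h.adj hD' hDK'),
      fun h => hD.orientation.not_adj hxy (h.adj hD hDK)⟩
  · exact cliqueOrientation_adj_iff.2 (exists_isAMO_of_residual_adj hG hα hαK h)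
  · exact cliqueOrientation_adj_iff.2 (exists_isAMO_of_residual_adj hG hα hαK h.symm)

theorem notMem_of_undirectedRest_adj {G : SimpleGraph V} {K : Set V} {x y : V}
    (h : (undirectedRest G K).Adj x y) : x ∉ K ∧ y ∉ K := by
  rw [undirectedRest, induce_spanningCoe_adj] at h
  exact ⟨h.1, h.2.1⟩

theorem notMem_of_undirectedRest_reachable {G : SimpleGraph V} {K : Set V} {x y : V} (hx : x ∉ K)
    (h : (undirectedRest G K).Reachable x y) : y ∉ K := by
  rcases ((reachable_iff_reflTransGen _ _).1 h).cases_tail with h | ⟨c, _, h⟩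
  · exact h ▸ hx
  · exact (notMem_of_undirectedRest_adj h).2

theorem isInducedOnComponents_undirectedRest [Finite V] {G : SimpleGraph V} (hG : IsChordal G)
    {K : Set V} (hK : G.IsClique K) : IsInducedOnComponents (undirectedRest G K) G where
  le := undirectedRest_le G K
  adj_of_reachable := by
    intro a b hab h
    obtain ⟨α, hα, hαK⟩ := hG.exists_isAMO hK
    have ha : a ∉ K := by
      rcases ((reachable_iff_reflTransGen _ _).1 hab).cases_head with h' | ⟨c, h', _⟩
      · exact absurd h' h.ne
      · exact (notMem_of_undirectedRest_adj h').1
    refine (undirectedRest_adj_iff hG hK).2 ⟨ha, notMem_of_undirectedRest_reachable ha hab, ?_⟩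
    refine (isInducedOnComponents_residual hα hαK).adj_of_reachable (hab.mono ?_) h
    exact fun _ _ h => ((undirectedRest_adj_iff hG hK).1 h).2.2

end

/-! ### Counting AMOs component by component -/

theorem numAMO_eq_card {V : Type u} (G : SimpleGraph V) :
    numAMO G = Nat.card {D : Digraph V // IsAMO G D} := rfl

/-- If `W` is the disjoint union of the graphs `X i`, an AMO of `W` is a family of AMOs of the
`X i`. -/
theorem numAMO_eq_prod {V : Type u} {W : SimpleGraph V} {ι : Type*} [Fintype ι] (S : ι → Set V)
    (hS : ∀ i j a, a ∈ S i → a ∈ S j → i = j) (X : ∀ i, SimpleGraph (S i))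
    (hX : ∀ a b, W.Adj a b ↔ ∃ i, ∃ (ha : a ∈ S i) (hb : b ∈ S i), (X i).Adj ⟨a, ha⟩ ⟨b, hb⟩) :
    numAMO W = ∏ i, numAMO (X i) := by
  have hXW : ∀ i (a b : S i), (X i).Adj a b ↔ W.Adj a b := by
    intro i a b
    rw [hX]
    constructor
    · exact fun h => ⟨i, a.2, b.2, h⟩
    · rintro ⟨j, ha, hb, h⟩
      obtain rfl := hS i j a a.2 ha
      exact h
  have hrestr : ∀ D : Digraph V, IsAMO W D → ∀ i,
      IsAMO (X i) ⟨fun a b : S i => D.Adj a b⟩ := by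
    intro D hD i
    refine isAMO_of (fun a b h => (hXW i a b).2 (hD.orientation.1 _ _ h))
      (fun a b h => hD.orientation.adj_or ((hXW i a b).1 h)) ?_
      (fun a b c h1 h2 h3 => (hXW i a c).2 (hD.adj_of_adj h1 h2 fun h => h3 (Subtype.ext h)))
    exact fun v hv => hD.acyclic v (hv.lift Subtype.val fun _ _ h => h)
  let Φ : {D : Digraph V // IsAMO W D} → ∀ i, {D : Digraph (S i) // IsAMO (X i) D} :=
    fun D i => ⟨_, hrestr D.1 D.2 i⟩
  have hΦ : Function.Bijective Φ := by
    constructor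
    · have key : ∀ D D' : {D : Digraph V // IsAMO W D}, Φ D = Φ D' →
          ∀ a b, D.1.Adj a b → D'.1.Adj a b := by
        intro D D' h a b hab
        obtain ⟨i, ha, hb, -⟩ := (hX a b).1 (D.2.orientation.1 _ _ hab)
        have h1 := congrArg (fun E => (E i).1.Adj ⟨a, ha⟩ ⟨b, hb⟩) h
        exact (iff_of_eq h1).1 hab
      intro D D' h
      refine Subtype.ext (Digraph.ext ?_)
      funext a b
      exact propext ⟨key D D' h a b, key D' D h.symm a b⟩
    · intro δ
      let D : Digraph V :=
        ⟨fun a b => ∃ i, ∃ (ha : a ∈ S i) (hb : b ∈ S i), (δ i).1.Adj ⟨a, ha⟩ ⟨b, hb⟩⟩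
      have hDi : ∀ i (a b : S i), D.Adj a b ↔ (δ i).1.Adj a b := by
        intro i a b
        constructor
        · rintro ⟨j, ha, hb, h⟩
          obtain rfl := hS i j a a.2 ha
          exact h
        · exact fun h => ⟨i, a.2, b.2, h⟩
      have hD : IsAMO W D := by
        refine isAMO_of ?_ ?_ ?_ ?_
        · rintro a b ⟨i, ha, hb, h⟩
          exact (hX a b).2 ⟨i, ha, hb, (δ i).2.orientation.1 _ _ h⟩
        · intro a b h
          obtain ⟨i, ha, hb, h⟩ := (hX a b).1 h
          exact ((δ i).2.orientation.adj_or h).imp (fun h' => ⟨i, ha, hb, h'⟩)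
            fun h' => ⟨i, hb, ha, h'⟩
        · have key : ∀ a b, Relation.TransGen D.Adj a b → ∃ i, ∃ (ha : a ∈ S i) (hb : b ∈ S i),
              Relation.TransGen (δ i).1.Adj ⟨a, ha⟩ ⟨b, hb⟩ := by
            intro a b hab
            induction hab with
            | single h =>
              obtain ⟨i, ha, hb, h⟩ := h
              exact ⟨i, ha, hb, .single h⟩
            | tail _ h ih =>
              obtain ⟨i, ha, hb, h1⟩ := ih
              obtain ⟨j, hb', hc, h⟩ := h
              obtain rfl := hS i j _ hb hb'
              exact ⟨i, ha, hc, h1.tail h⟩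
          intro v hv
          obtain ⟨i, _, _, h⟩ := key v v hv
          exact (δ i).2.acyclic _ h
        · rintro a b c ⟨i, ha, hb, hab⟩ ⟨j, hc, hb', hcb⟩ hac
          obtain rfl := hS i j b hb hb'
          exact (hX a c).2 ⟨i, ha, hc, (δ i).2.adj_of_adj hab hcb fun h => hac
            (congrArg Subtype.val h)⟩
      refine ⟨⟨D, hD⟩, funext fun i => Subtype.ext (Digraph.ext ?_)⟩
      funext a b
      exact propext (hDi i a b)
  rw [numAMO_eq_card, Nat.card_congr (Equiv.ofBijective Φ hΦ), Nat.card_pi]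
  rfl

section
variable {V : Type u} {G : SimpleGraph V} {K : Set V}

theorem componentAt_eq {x y : V} (h : (undirectedRest G K).Reachable x y) :
    componentAt G K x = componentAt G K y := by
  have hxy : ∀ z, (undirectedRest G K).Reachable x z ↔ (undirectedRest G K).Reachable y z :=
    fun z => ⟨fun h' => h.symm.trans h', fun h' => h.trans h'⟩
  ext a b
  · exact hxy a
  · exact and_congr (hxy a) Iff.rfl

theorem numAMO_undirectedRest [Finite V] :
    numAMO (undirectedRest G K) = ∏ᶠ H ∈ components G K, numAMO H.coe := by
  have := Fintype.ofFinite (components G K)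
  rw [← finprod_set_coe_eq_finprod_mem, finprod_eq_prod_of_fintype]
  refine numAMO_eq_prod (fun H : components G K => H.1.verts) ?_ (fun H => H.1.coe) ?_
  · rintro ⟨_, x, hx, rfl⟩ ⟨_, y, hy, rfl⟩ a hxa hya
    exact Subtype.ext (componentAt_eq (Reachable.trans hxa (Reachable.symm hya)))
  · intro a b
    constructor
    · intro h
      exact ⟨⟨_, a, (notMem_of_undirectedRest_adj h).1, rfl⟩, Reachable.refl _, h.reachable,
        Reachable.refl _, h⟩
    · rintro ⟨⟨_, x, hx, rfl⟩, _, _, _, h⟩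
      exact h

/-! ### AMOs beginning with a clique -/

/-- A list sorted by `r` begins with the members of any set closed under `r`-predecessors. -/
theorem exists_isPrefix_of_pairwise {r : V → V → Prop} {l : List V} (hl : l.Pairwise r) {S : Set V}
    (hS : ∀ a b, b ∈ S → r a b → a ∈ S) : ∃ σ, σ <+: l ∧ ∀ x, x ∈ σ ↔ x ∈ l ∧ x ∈ S := by
  induction l with
  | nil => exact ⟨[], List.prefix_refl _, by simp⟩
  | cons a l ih =>
    obtain ⟨ha, hl'⟩ := List.pairwise_cons.1 hl
    by_cases haS : a ∈ S
    · obtain ⟨σ, h1, h2⟩ := ih hl'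
      refine ⟨a :: σ, List.cons_prefix_cons.2 ⟨rfl, h1⟩, fun x => ?_⟩
      simp only [List.mem_cons, h2]
      constructor
      · rintro (rfl | h)
        · exact ⟨Or.inl rfl, haS⟩
        · exact ⟨Or.inr h.1, h.2⟩
      · rintro ⟨rfl | h, h'⟩
        · exact Or.inl rfl
        · exact Or.inr ⟨h, h'⟩
    · refine ⟨[], List.nil_prefix, fun x => ?_⟩
      simp only [List.not_mem_nil, List.mem_cons, false_iff]
      rintro ⟨rfl | h, h'⟩
      · exact haS h'
      · exact haS (hS a x h' (ha x h))

theorem exists_isPrefix_iff_isInitial {D : Digraph V} (hD : ∀ a b, D.Adj a b → ¬ D.Adj b a)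
    (hK : IsInitial D K) {π : List V} (hπ : IsPermutationOf π K) (hs : π.Pairwise D.Adj)
    {S : Set V} (hS : S ⊆ K) :
    (∃ σ : List V, σ <+: π ∧ IsPermutationOf σ S) ↔ IsInitial D S := by
  constructor
  · rintro ⟨σ, h1, h2⟩ x s hs' hxs
    have hsK := hS hs'
    have hne : x ≠ s := by
      rintro rfl
      exact hD _ _ hxs hxs
    refine (h2.2 x).1 (mem_of_sublist_pair_of_isPrefix hπ.1 h1 ?_ ((h2.2 s).2 hs'))
    exact sublist_pair_of_pairwise hs ((hπ.2 x).2 (hK hsK hxs)) ((hπ.2 s).2 hsK) hne (hD _ _ hxs)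
  · intro h
    obtain ⟨σ, h1, h2⟩ := exists_isPrefix_of_pairwise hs fun a b hb hab => h hb hab
    refine ⟨σ, h1, hπ.1.sublist h1.sublist, fun x => ?_⟩
    rw [h2, hπ.2]
    exact ⟨fun h => h.2, fun h => ⟨hS h, h⟩⟩

/-- The digraph `β` together with the edges between members of `π`, directed along `π`. -/
def addOrder (β : Digraph V) (π : List V) : Digraph V where
  Adj a b := β.Adj a b ∨ [a, b].Sublist π

theorem mem_of_sublist_pair {π : List V} {a b : V} (h : [a, b].Sublist π) : a ∈ π ∧ b ∈ π :=
  ⟨h.subset (by simp), h.subset (by simp)⟩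

/-- An AMO of the unforced edges consists of an ordering of the clique `K` and an AMO of the
unforced edges outside `K`. -/
theorem isAMO_addOrder [Finite V] (hG : IsChordal G) (hK : G.IsClique K) {π : List V}
    (hπ : IsPermutationOf π K) {β : Digraph V} (hβ : IsAMO (undirectedRest G K) β) :
    IsAMO (residual G K) (addOrder β π) := by
  classical
  obtain ⟨α, hα, hαK⟩ := hG.exists_isAMO hK
  have hβK : ∀ {a b}, β.Adj a b → a ∉ K ∧ b ∉ K ∧ (residual G K).Adj a b :=
    fun h => (undirectedRest_adj_iff hG hK).1 (hβ.orientation.1 _ _ h)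
  have hπK : ∀ {a b}, [a, b].Sublist π → a ∈ K ∧ b ∈ K :=
    fun h => ⟨(hπ.2 _).1 (mem_of_sublist_pair h).1, (hπ.2 _).1 (mem_of_sublist_pair h).2⟩
  have hKadj : ∀ {a b}, a ∈ K → b ∈ K → a ≠ b → (residual G K).Adj a b := fun ha hb hab =>
    ⟨hK ha hb hab, fun h => h.notMem hα hαK hb, fun h => h.notMem hα hαK ha⟩
  have hidx : ∀ {a b}, [a, b].Sublist π → π.idxOf a < π.idxOf b := by
    intro a b h
    have hmem := mem_of_sublist_pair h
    by_contra hlt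
    have hne : a ≠ b := by
      rintro rfl
      exact not_sublist_pair_swap hπ.1 h h
    have hp : π.Pairwise fun x y => π.idxOf x < π.idxOf y := by
      rw [List.pairwise_iff_getElem]
      intro i j hi hj hij
      rwa [hπ.1.idxOf_getElem, hπ.1.idxOf_getElem]
    exact hlt (List.pairwise_iff_forall_sublist.1 hp h)
  refine isAMO_of ?_ ?_ ?_ ?_
  · rintro a b (h | h)
    · exact (hβK h).2.2
    · refine hKadj (hπK h).1 (hπK h).2 ?_
      rintro rfl
      exact lt_irrefl _ (hidx h)
  · intro a b h
    by_cases ha : a ∈ K <;> by_cases hb : b ∈ K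
    · exact (sublist_pair_or ((hπ.2 a).2 ha) ((hπ.2 b).2 hb) h.ne).imp Or.inr Or.inr
    · exact absurd (Forced.base ha hb h.1) h.2.1
    · exact absurd (Forced.base hb ha h.1.symm) h.2.2
    · exact (hβ.orientation.adj_or ((undirectedRest_adj_iff hG hK).2 ⟨ha, hb, h⟩)).imp
        Or.inl Or.inl
  · have key : ∀ a b, Relation.TransGen (addOrder β π).Adj a b →
        (a ∉ K ∧ b ∉ K ∧ Relation.TransGen β.Adj a b) ∨
        (a ∈ K ∧ b ∈ K ∧ π.idxOf a < π.idxOf b) := by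
      intro a b hab
      induction hab with
      | single h =>
        rcases h with h | h
        · exact Or.inl ⟨(hβK h).1, (hβK h).2.1, .single h⟩
        · exact Or.inr ⟨(hπK h).1, (hπK h).2, hidx h⟩
      | tail _ h ih =>
        rcases h with h | h <;> rcases ih with ⟨h1, h2, h3⟩ | ⟨h1, h2, h3⟩
        · exact Or.inl ⟨h1, (hβK h).2.1, h3.tail h⟩
        · exact absurd h2 (hβK h).1
        · exact absurd (hπK h).1 h2
        · exact Or.inr ⟨h1, (hπK h).2, h3.trans (hidx h)⟩
    intro v hv
    rcases key v v hv with ⟨-, -, h⟩ | ⟨-, -, h⟩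
    · exact hβ.acyclic v h
    · exact lt_irrefl _ h
  · rintro a b c (hab | hab) (hcb | hcb) hac
    · exact ((undirectedRest_adj_iff hG hK).1 (hβ.adj_of_adj hab hcb hac)).2.2
    · exact absurd (hπK hcb).2 (hβK hab).2.1
    · exact absurd (hπK hab).2 (hβK hcb).2.1
    · exact hKadj (hπK hab).1 (hπK hcb).1 hac

theorem IsAMO.eq_of_le {D D' : Digraph V} (h : IsAMO G D) (h' : IsAMO G D')
    (hle : ∀ a b, D.Adj a b → D'.Adj a b) : D = D' := by
  refine Digraph.ext ?_
  funext a b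
  refine propext ⟨hle a b, fun hab => ?_⟩
  exact (h.orientation.adj_or (h'.orientation.1 _ _ hab)).resolve_right
    fun hba => h'.orientation.not_adj hab (hle _ _ hba)

/-- The AMOs in which the clique `K` is initial and no member of `R` is: they are given by a
permutation of `K` without a prefix in `R` and an AMO of the undirected part of `G^K[V \ K]`. -/
theorem ncard_isAMO_isInitial [Finite V] (hG : IsChordal G) (hK : G.IsClique K)
    {R : Set (Set V)} (hR : ∀ S ∈ R, S ⊆ K) :
    {D : Digraph V | IsAMO G D ∧ IsInitial D K ∧ ∀ S ∈ R, ¬ IsInitial D S}.ncard =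
      phi K R * numAMO (undirectedRest G K) := by
  obtain ⟨α, hα, hαK⟩ := hG.exists_isAMO hK
  let Φ : List V × Digraph V → Digraph V := fun q => glue G K (addOrder q.2 q.1)
  set P := {π : List V | IsPermutationOf π K ∧
    ∀ S' ∈ R, ¬ ∃ σ : List V, σ <+: π ∧ IsPermutationOf σ S'}
  set Q := {β : Digraph V | IsAMO (undirectedRest G K) β}
  have hamo : ∀ q ∈ P ×ˢ Q, IsAMO G (Φ q) ∧ IsInitial (Φ q) K := fun q hq =>
    have h := isAMO_addOrder hG hK hq.1.1 hq.2
    ⟨isAMO_glue hα hαK h, isInitial_glue hα hαK h⟩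
  have hsorted : ∀ q ∈ P ×ˢ Q, q.1.Pairwise (Φ q).Adj := fun q _ =>
    List.pairwise_iff_forall_sublist.2 fun h => Or.inr (Or.inr h)
  have himg : {D : Digraph V | IsAMO G D ∧ IsInitial D K ∧ ∀ S ∈ R, ¬ IsInitial D S} =
      Φ '' (P ×ˢ Q) := by
    ext D
    constructor
    · rintro ⟨hD, hDK, hDR⟩
      obtain ⟨π, ρ, hπ, hτ⟩ := hD.acyclic.exists_isTopologicalOrdering hDK
      have hs : π.Pairwise D.Adj := by
        rw [List.pairwise_iff_forall_sublist]
        intro a b hab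
        have hne : a ≠ b := by
          rintro rfl
          exact not_sublist_pair_swap hπ.1 hab hab
        have hmem := mem_of_sublist_pair hab
        refine (hD.orientation.adj_or (hK ((hπ.2 a).1 hmem.1) ((hπ.2 b).1 hmem.2) hne)).resolve_right
          fun hba => ?_
        exact not_sublist_pair_swap hτ.1.1 (hab.trans (List.sublist_append_left _ _)) (hτ.2 _ _ hba)
      have hq : (π, restrict D (undirectedRest G K)) ∈ P ×ˢ Q :=
        ⟨⟨hπ, fun S hS h => hDR S hS ((exists_isPrefix_iff_isInitial
          (fun _ _ => hD.orientation.not_adj) hDK hπ hs (hR S hS)).1 h)⟩,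
          (isInducedOnComponents_undirectedRest hG hK).isAMO_restrict hD⟩
      refine ⟨_, hq, (hamo _ hq).1.eq_of_le hD ?_⟩
      rintro a b (h | h | h)
      · exact h.adj hD hDK
      · exact h.1
      · exact List.pairwise_iff_forall_sublist.1 hs h
    · rintro ⟨q, hq, rfl⟩
      obtain ⟨h1, h2⟩ := hamo q hq
      refine ⟨h1, h2, fun S hS h => hq.1.2 S hS ?_⟩
      exact (exists_isPrefix_iff_isInitial (fun _ _ => h1.orientation.not_adj) h2 hq.1.1
        (hsorted q hq) (hR S hS)).2 h
  have hinj : Set.InjOn Φ (P ×ˢ Q) := by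
    rintro ⟨π, β⟩ hq ⟨π', β'⟩ hq' h
    have h1 := hsorted _ hq
    have h2 := hsorted _ hq'
    rw [← h] at h2
    have hD := (hamo _ hq).1
    have hperm : π.Perm π' := (List.perm_ext_iff_of_nodup hq.1.1.1 hq'.1.1.1).2 fun x =>
      (hq.1.1.2 x).trans (hq'.1.1.2 x).symm
    have hππ : π = π' := hperm.eq_of_pairwise
      (fun a b _ _ hab hba => absurd hba (hD.orientation.not_adj hab)) h1 h2
    -- outside `K`, on the unforced edges, only `β` contributes
    have hββ : ∀ q ∈ P ×ˢ Q, restrict (Φ q) (undirectedRest G K) = q.2 := by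
      intro q hq
      refine Digraph.ext ?_
      funext a b
      refine propext ⟨?_, fun h => ⟨Or.inr (Or.inl h), hq.2.orientation.1 _ _ h⟩⟩
      rintro ⟨h | h | h, h'⟩
      · exact absurd h ((undirectedRest_adj_iff hG hK).1 h').2.2.2.1
      · exact h
      · exact absurd ((hq.1.1.2 a).1 (mem_of_sublist_pair h).1) (notMem_of_undirectedRest_adj h').1
    have h3 := hββ _ hq
    rw [h, hββ _ hq'] at h3
    exact Prod.ext hππ h3.symm
  rw [himg, hinj.ncard_image, Set.ncard_prod]
  rfl

end

/-! ### Rooted trees -/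

section
variable {N : Type w} {T : SimpleGraph N} {r : N}

/-- The last node before `x` on the path from `r` to `x` in a tree; for `x = r` it is `r`. -/
noncomputable def treeParent (hT : T.IsTree) (r x : N) : N :=
  (hT.existsUnique_path r x).choose.penultimate

theorem treeParent_eq_penultimate (hT : T.IsTree) {x : N} {p : T.Walk r x} (hp : p.IsPath) :
    treeParent hT r x = p.penultimate := by
  rw [treeParent, (hT.existsUnique_path r x).choose_spec.2 p hp]

theorem treeParent_getVert (hT : T.IsTree) {x : N} {p : T.Walk r x} (hp : p.IsPath) {i : ℕ}
    (hi : i < p.length) : p.getVert (i + 1) ≠ r ∧ treeParent hT r (p.getVert (i + 1)) =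
      p.getVert i := by
  constructor
  · intro h
    have := hp.getVert_injOn (x₁ := i + 1) (x₂ := 0) (by simp; omega) (by simp) (by simpa using h)
    omega
  · rw [treeParent_eq_penultimate hT (hp.take (i + 1)), Walk.penultimate, Walk.take_length,
      Walk.take_getVert]
    congr 1
    omega

theorem adj_treeParent (hT : T.IsTree) {x : N} (hx : x ≠ r) :
    T.Adj (treeParent hT r x) x ∧ T.dist r (treeParent hT r x) + 1 = T.dist r x := by
  obtain ⟨p, hp, hlen⟩ := hT.connected.exists_path_of_dist r x
  have hnil : ¬ p.Nil := fun h => hx h.eq.symm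
  rw [treeParent_eq_penultimate hT hp]
  have hadj := p.adj_penultimate hnil
  refine ⟨hadj, ?_⟩
  have hpos : 0 < p.length := by
    rw [Nat.pos_iff_ne_zero]
    exact fun h => hnil (Walk.length_eq_zero_iff.1 h)
  have h1 := dist_le (p.take (p.length - 1))
  rw [Walk.take_length] at h1
  change T.dist r p.penultimate ≤ _ at h1
  rcases hT.dist_eq_dist_add_one_of_adj r hadj with h | h <;> omega

theorem treeParent_eq_or (hT : T.IsTree) (r : N) {x y : N} (h : T.Adj x y) :
    (y ≠ r ∧ treeParent hT r y = x) ∨ (x ≠ r ∧ treeParent hT r x = y) := by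
  obtain ⟨p, hp, -⟩ := hT.existsUnique_path r x
  by_cases hy : y ∈ p.support
  · have h1 := hT.isAcyclic.eq_penultimate_of_adj_end hp h hy
    refine Or.inr ⟨?_, (treeParent_eq_penultimate hT hp).trans h1.symm⟩
    rintro rfl
    have : p.Nil := (Walk.isPath_iff_nil (p := p)).1 hp
    rw [Walk.nil_iff_support_eq.1 this] at hy
    exact h.ne (List.mem_singleton.1 hy).symm
  · refine Or.inl ⟨?_, ?_⟩
    · rintro rfl
      exact hy p.start_mem_support
    · rw [treeParent_eq_penultimate hT (hp.concat hy h), Walk.penultimate_concat]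

end

namespace RootedCliqueTree

variable {V : Type u} {G : SimpleGraph V} (T : RootedCliqueTree.{u, w} G)

/-- The parent of a node; the root is its own parent. -/
noncomputable def parent (x : T.Node) : T.Node := treeParent T.isTree T.root x

/-- The distance of a node from the root. -/
noncomputable def depth (x : T.Node) : ℕ := T.tree.dist T.root x

/-- `x` lies on the path from the root to `y`. -/
def IsAncestor (x y : T.Node) : Prop :=
  Relation.ReflTransGen (fun a b => b ≠ T.root ∧ a = T.parent b) x y

variable {T}

theorem depth_parent {x : T.Node} (hx : x ≠ T.root) : T.depth (T.parent x) + 1 = T.depth x :=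
  (adj_treeParent T.isTree hx).2

theorem adj_cases {x y : T.Node} (h : T.tree.Adj x y) :
    (y ≠ T.root ∧ T.parent y = x) ∨ (x ≠ T.root ∧ T.parent x = y) :=
  treeParent_eq_or T.isTree T.root h

theorem mem_children_iff {x y : T.Node} :
    y ∈ T.children x ↔ y ≠ T.root ∧ T.parent y = x := by
  constructor
  · rintro ⟨h1, h2⟩
    refine (adj_cases h1).resolve_right ?_
    rintro ⟨h3, rfl⟩
    have := depth_parent h3
    rw [depth, depth] at this
    omega
  · rintro ⟨h1, rfl⟩
    have := adj_treeParent T.isTree h1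
    exact ⟨this.1, by rw [← this.2]; exact Nat.lt_succ_self _⟩

theorem IsAncestor.eq_or {x y : T.Node} (h : T.IsAncestor x y) :
    x = y ∨ (y ≠ T.root ∧ T.IsAncestor x (T.parent y)) := by
  rcases Relation.ReflTransGen.cases_tail h with h | ⟨c, h1, h2, rfl⟩
  · exact Or.inl h.symm
  · exact Or.inr ⟨h2, h1⟩

theorem isAncestor_parent {x : T.Node} (hx : x ≠ T.root) : T.IsAncestor (T.parent x) x :=
  .single ⟨hx, rfl⟩

theorem IsAncestor.eq_of_root {x : T.Node} (h : T.IsAncestor x T.root) : x = T.root :=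
  h.eq_or.resolve_right fun h' => h'.1 rfl

theorem isAncestor_root (x : T.Node) : T.IsAncestor T.root x := by
  induction hn : T.depth x using Nat.strong_induction_on generalizing x with
  | _ n ih =>
    by_cases hx : x = T.root
    · subst hx; exact .refl
    · have := depth_parent hx
      exact (ih _ (by omega) _ rfl).trans (isAncestor_parent hx)

theorem IsAncestor.eq_or_depth_lt {x y : T.Node} (h : T.IsAncestor x y) :
    x = y ∨ T.depth x < T.depth y := by
  unfold IsAncestor at h
  induction h with
  | refl => exact Or.inl rfl
  | @tail b c _ h ih =>
    obtain ⟨h1, rfl⟩ := h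
    have := depth_parent h1
    right
    rcases ih with rfl | ih <;> omega

theorem IsAncestor.antisymm {x y : T.Node} (h : T.IsAncestor x y) (h' : T.IsAncestor y x) :
    x = y := by
  rcases h.eq_or_depth_lt with h1 | h1
  · exact h1
  · rcases h'.eq_or_depth_lt with h2 | h2
    · exact h2.symm
    · omega

theorem mem_forbiddenPrefixes_iff {v : T.Node} {S : Set V} :
    S ∈ T.forbiddenPrefixes v ↔ ∃ x, x ≠ T.root ∧ T.IsAncestor x v ∧
      S = T.bag (T.parent x) ∩ T.bag x ∧ S ⊆ T.bag v := by
  constructor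
  · rintro ⟨p, hp, i, hi, rfl, hS⟩
    obtain ⟨h1, h2⟩ := treeParent_getVert T.isTree hp hi
    refine ⟨_, h1, ?_, by rw [parent, h2], hS⟩
    have key : ∀ k, i + 1 + k ≤ p.length →
        T.IsAncestor (p.getVert (i + 1)) (p.getVert (i + 1 + k)) := by
      intro k
      induction k with
      | zero => exact fun _ => .refl
      | succ k ih =>
        intro hk
        obtain ⟨h3, h4⟩ := treeParent_getVert T.isTree hp (i := i + 1 + k) (by omega)
        exact (ih (by omega)).tail ⟨h3, h4.symm⟩
    have := key (p.length - (i + 1)) (by omega)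
    rwa [show i + 1 + (p.length - (i + 1)) = p.length by omega, p.getVert_length] at this
  · rintro ⟨x, hx, hxv, rfl, hS⟩
    obtain ⟨p, hp, -⟩ := T.isTree.existsUnique_path T.root v
    have key : ∃ j ≤ p.length, p.getVert j = x := by
      unfold IsAncestor at hxv
      clear hx hS
      induction hxv using Relation.ReflTransGen.head_induction_on with
      | refl => exact ⟨p.length, le_rfl, p.getVert_length⟩
      | @head a c h _ ih =>
        obtain ⟨h1, rfl⟩ := h
        obtain ⟨j, hj, rfl⟩ := ih
        rcases j with _ | j
        · exact absurd p.getVert_zero h1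
        · exact ⟨j, by omega, (treeParent_getVert T.isTree hp hj).2.symm⟩
    obtain ⟨j, hj, rfl⟩ := key
    rcases j with _ | j
    · exact absurd p.getVert_zero hx
    · refine ⟨p, hp, j, hj, ?_, hS⟩
      rw [parent, (treeParent_getVert T.isTree hp hj).2]

/-- A vertex whose bags occur both inside and outside the subtree below `x` lies in the bags of
both ends of the edge above `x`. -/
theorem mem_bag_of_isAncestor {x u u' : T.Node} {z : V} (hu : z ∈ T.bag u) (hu' : z ∈ T.bag u')
    (h : T.IsAncestor x u) (h' : ¬ T.IsAncestor x u') :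
    x ≠ T.root ∧ z ∈ T.bag (T.parent x) ∩ T.bag x := by
  refine ⟨fun hx => h' (hx ▸ isAncestor_root u'), ?_⟩
  by_contra hn
  have hr := (T.connected z).preconnected ⟨u, hu⟩ ⟨u', hu'⟩
  rw [reachable_iff_reflTransGen] at hr
  have key : ∀ y : {y | z ∈ T.bag y},
      Relation.ReflTransGen (T.tree.induce {y | z ∈ T.bag y}).Adj ⟨u, hu⟩ y →
      T.IsAncestor x y := by
    intro y hy
    induction hy with
    | refl => exact h
    | @tail a b _ hab ih =>
      rcases adj_cases (T := T) (x := a) (y := b) hab with ⟨h1, h2⟩ | ⟨h1, h2⟩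
      · exact ih.trans (h2 ▸ isAncestor_parent h1)
      · rcases ih.eq_or with rfl | ⟨-, h3⟩
        · exact absurd ⟨h2 ▸ b.2, a.2⟩ hn
        · exact h2 ▸ h3
  exact h' (key _ hr)

theorem isClique_bag (v : T.Node) : G.IsClique (T.bag v) :=
  (T.bag_bijOn.mapsTo (Set.mem_univ v)).prop

theorem bag_subset_iff {v v' : T.Node} : T.bag v ⊆ T.bag v' ↔ v = v' := by
  refine ⟨fun h => T.bag_bijOn.injOn trivial trivial ?_, fun h => h ▸ le_rfl⟩
  exact (T.bag_bijOn.mapsTo (Set.mem_univ v)).eq_of_subset (isClique_bag v') h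

theorem exists_bag_of_adj [Finite V] {a b : V} (h : G.Adj a b) :
    ∃ u, a ∈ T.bag u ∧ b ∈ T.bag u := by
  obtain ⟨M, hle, hM⟩ := (Set.toFinite {M : Set V | G.IsClique M}).exists_le_maximal
    (a := {a, b}) (by
      intro x hx y hy hxy
      rcases hx with rfl | rfl <;> rcases hy with rfl | rfl
      · exact absurd rfl hxy
      · exact h
      · exact h.symm
      · exact absurd rfl hxy)
  obtain ⟨u, -, rfl⟩ := T.bag_bijOn.surjOn hM
  exact ⟨u, hle (by simp), hle (by simp)⟩

variable (T) in
theorem finite_node [Finite V] : Finite T.Node :=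
  Finite.of_injective T.bag fun _ _ h => T.bag_bijOn.injOn trivial trivial h

/-! ### Every AMO is counted at exactly one node -/

/-- `S` is closed under those predecessors in `D` that lie in a bag of a node of `W`. -/
def IsInitialIn (T : RootedCliqueTree.{u, w} G) (D : Digraph V) (W : Set T.Node) (S : Set V) :
    Prop :=
  ∀ s ∈ S, ∀ y ∈ W, ∀ x ∈ T.bag y, D.Adj x s → x ∈ S

theorem IsInitialIn.mono {D : Digraph V} {W W' : Set T.Node} {S : Set V} (hW : W ⊆ W')
    (h : T.IsInitialIn D W' S) : T.IsInitialIn D W S :=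
  fun s hs y hy => h s hs y (hW hy)

/-- Existence of a node whose bag is initial and has no initial forbidden prefix: the node is
found for growing subtrees `W` containing the root. When a node `ℓ` is added and the node `v`
found for `W` is not good any more, then because of an edge `p → s` with `s` in the bag of `v` and
`p` occurring only in the bag of `ℓ`; in this case `ℓ` is good. -/
theorem exists_isInitial_bag [Finite V] {D : Digraph V} (hD : IsAMO G D) :
    ∃ v, IsInitial D (T.bag v) ∧ ∀ S ∈ T.forbiddenPrefixes v, ¬ IsInitial D S := by
  have := T.finite_node
  let P : Set T.Node → Prop := fun W => T.root ∈ W ∧ (∀ x ∈ W, x ≠ T.root → T.parent x ∈ W) ∧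
    ∃ v ∈ W, T.IsInitialIn D W (T.bag v) ∧ ∀ S ∈ T.forbiddenPrefixes v, ¬ T.IsInitialIn D W S
  have hbase : P {T.root} := by
    refine ⟨rfl, fun x hx hx' => absurd hx hx', T.root, rfl, ?_, ?_⟩
    · rintro s - y rfl x hx -
      exact hx
    · intro S hS
      obtain ⟨x, h1, h2, -⟩ := mem_forbiddenPrefixes_iff.1 hS
      exact absurd h2.eq_of_root h1
  obtain ⟨W, -, hW⟩ := (Set.toFinite {W | P W}).exists_le_maximal hbase
  obtain ⟨hroot, hpar, v, hvW, hv, hvR⟩ := hW.prop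
  have hanc : ∀ x y, T.IsAncestor x y → y ∈ W → x ∈ W := by
    intro x y h
    unfold IsAncestor at h
    induction h with
    | refl => exact id
    | tail _ h ih =>
      obtain ⟨h1, rfl⟩ := h
      exact fun hc => ih (hpar _ hc h1)
  have huniv : W = Set.univ := by
    by_contra hne
    obtain ⟨ℓ, hℓW, hℓ⟩ : ∃ ℓ, ℓ ∉ W ∧ T.parent ℓ ∈ W := by
      obtain ⟨x, hx⟩ := (Set.ne_univ_iff_exists_notMem _).1 hne
      by_contra hcon
      push Not at hcon
      have : ∀ n x, T.depth x = n → x ∈ W := by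
        intro n
        induction n with
        | zero =>
          intro x hx
          by_contra hxW
          have := depth_parent (T := T) (x := x) fun h => hxW (h ▸ hroot)
          omega
        | succ n ih =>
          intro x hx
          by_contra hxW
          have := depth_parent (T := T) (x := x) fun h => hxW (h ▸ hroot)
          exact hcon x hxW (ih _ (by omega))
      exact hx (this _ x rfl)
    have hℓr : ℓ ≠ T.root := fun h => hℓW (h ▸ hroot)
    have hnotanc : ∀ y ∈ W, ¬ T.IsAncestor ℓ y := fun y hy h => hℓW (hanc _ _ h hy)
    -- `P (insert ℓ W)` contradicts the maximality of `W`
    suffices hP : P (insert ℓ W) from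
      hℓW (hW.2 hP (Set.subset_insert _ _) (Set.mem_insert _ _))
    refine ⟨Or.inr hroot, ?_, ?_⟩
    · rintro x (rfl | hx) hxr
      · exact Or.inr hℓ
      · exact Or.inr (hpar x hx hxr)
    by_cases hgood : T.IsInitialIn D (insert ℓ W) (T.bag v)
    · exact ⟨v, Or.inr hvW, hgood, fun S hS h => hvR S hS (h.mono (Set.subset_insert _ _))⟩
    obtain ⟨s, hsv, p, hpℓ, hps, hpv, hpW⟩ : ∃ s ∈ T.bag v, ∃ p ∈ T.bag ℓ, D.Adj p s ∧
        p ∉ T.bag v ∧ ∀ y ∈ W, p ∉ T.bag y := by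
      unfold IsInitialIn at hgood
      push Not at hgood
      obtain ⟨s, hs, y, hy, p, hp, hps, hpv⟩ := hgood
      have hpW : ∀ y ∈ W, p ∉ T.bag y := fun y hy hp => hpv (hv s hs y hy p hp hps)
      rcases hy with rfl | hy
      · exact ⟨s, hs, p, hp, hps, hpv, hpW⟩
      · exact absurd hp (hpW y hy)
    -- a neighbour of a vertex private to `ℓ` that occurs in `W` also occurs in `ℓ`
    have hprivate : ∀ q, G.Adj p q → ∀ y ∈ W, q ∈ T.bag y → q ∈ T.bag ℓ := by
      intro q hpq y hy hqy
      obtain ⟨u, hpu, hqu⟩ := T.exists_bag_of_adj hpq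
      by_cases hu : T.IsAncestor ℓ u
      · exact (mem_bag_of_isAncestor hqu hqy hu (hnotanc y hy)).2.2
      · exact absurd (mem_bag_of_isAncestor hpℓ hpu .refl hu).2.1 (hpW _ hℓ)
    have hsℓ : s ∈ T.bag ℓ := hprivate s (hD.orientation.1 _ _ hps) v hvW hsv
    refine ⟨ℓ, Or.inl rfl, ?_, ?_⟩
    · intro q hq y hy x hxy hxq
      by_contra hxℓ
      have hyW : y ∈ W := hy.resolve_left fun h => hxℓ (h ▸ hxy)
      have hpx : ¬ G.Adj p x := fun h => hxℓ (hprivate x h y hyW hxy)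
      have hpx' : p ≠ x := fun h => hxℓ (h ▸ hpℓ)
      have hqW : q ∈ T.bag (T.parent ℓ) := by
        obtain ⟨u, hxu, hqu⟩ := T.exists_bag_of_adj (hD.orientation.1 _ _ hxq)
        by_cases hu : T.IsAncestor ℓ u
        · exact absurd (mem_bag_of_isAncestor hxu hxy hu (hnotanc y hyW)).2.2 hxℓ
        · exact (mem_bag_of_isAncestor hq hqu .refl hu).2.1
      have hpq' : p ≠ q := fun h => hpW _ hℓ (h ▸ hqW)
      have hpq : ¬ D.Adj p q := fun h => hpx (hD.adj_of_adj h hxq hpx')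
      have hqp : D.Adj q p := (hD.orientation.adj_or (isClique_bag ℓ hq hpℓ hpq'.symm)).resolve_right
        hpq
      have hqv : q ∈ T.bag v := by
        by_contra hqv
        have hqs : q ≠ s := fun h => hqv (h ▸ hsv)
        rcases hD.orientation.adj_or (isClique_bag ℓ hq hsℓ hqs) with h | h
        · exact hqv (hv s hsv _ hℓ q hqW h)
        · exact hD.acyclic p (((Relation.TransGen.single hps).tail h).tail hqp)
      have hxv : x ∈ T.bag v := hv q hqv y hyW x hxy hxq
      have hxs : x ≠ s := fun h => hxℓ (h ▸ hsℓ)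
      rcases hD.orientation.adj_or (isClique_bag v hxv hsv hxs) with h | h
      · exact hpx (hD.adj_of_adj hps h hpx')
      · exact hD.acyclic p ((((Relation.TransGen.single hps).tail h).tail hxq).tail hqp)
    · intro S hS hSI
      obtain ⟨x, hxr, hxℓ, rfl, hSℓ⟩ := mem_forbiddenPrefixes_iff.1 hS
      have hxW : T.parent x ∈ W := by
        rcases hxℓ.eq_or with rfl | ⟨-, h⟩
        · exact hℓ
        · exact hanc _ _ ((isAncestor_parent hxr).trans h) hℓ
      have hsS : s ∉ T.bag (T.parent x) ∩ T.bag x := fun h =>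
        hpW _ hxW (hSI s h ℓ (Or.inl rfl) p hpℓ hps).1
      have hSv : T.bag (T.parent x) ∩ T.bag x ⊆ T.bag v := by
        intro t ht
        have hts : t ≠ s := fun h => hsS (h ▸ ht)
        rcases hD.orientation.adj_or (isClique_bag ℓ (hSℓ ht) hsℓ hts) with h | h
        · exact hv s hsv _ hxW t ht.1 h
        · exact absurd (hSI t ht v (Or.inr hvW) s hsv h) hsS
      by_cases hxv : T.IsAncestor x v
      · exact hvR _ (mem_forbiddenPrefixes_iff.2 ⟨x, hxr, hxv, rfl, hSv⟩)
          (hSI.mono (Set.subset_insert _ _))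
      · exact hsS (mem_bag_of_isAncestor hsℓ hsv hxℓ hxv).2
  have hcover : ∀ S, T.IsInitialIn D W S ↔ IsInitial D S := by
    intro S
    constructor
    · intro h x s hs hxs
      obtain ⟨u, hxu, -⟩ := T.exists_bag_of_adj (hD.orientation.1 _ _ hxs)
      exact h s hs u (huniv ▸ trivial) x hxu hxs
    · exact fun h s hs y _ x _ hxs => h hs hxs
  exact ⟨v, (hcover _).1 hv, fun S hS h => hvR S hS ((hcover _).2 h)⟩

/-- The deepest common ancestor of `v` and `v'`, with a property `P` that is passed on from `v`
upwards as long as the node is not an ancestor of `v'`. -/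
theorem exists_common_ancestor {v' : T.Node} (P : T.Node → Prop) {v : T.Node} (hv : P v)
    (h : ∀ z, T.IsAncestor z v → ¬ T.IsAncestor z v' → z ≠ T.root → P z → P (T.parent z)) :
    ∃ m, T.IsAncestor m v ∧ T.IsAncestor m v' ∧ P m ∧
      ∀ z, T.IsAncestor z v → T.IsAncestor z v' → T.IsAncestor z m := by
  induction hn : T.depth v using Nat.strong_induction_on generalizing v with
  | _ n ih =>
    by_cases hvv' : T.IsAncestor v v'
    · exact ⟨v, .refl, hvv', hv, fun z hz _ => hz⟩
    · have hvr : v ≠ T.root := fun h => hvv' (h ▸ isAncestor_root v')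
      have hd := depth_parent hvr
      obtain ⟨m, h1, h2, h3, h4⟩ := ih (T.depth (T.parent v)) (by omega)
        (h v .refl hvv' hvr hv)
        (fun z hz => h z (hz.trans (isAncestor_parent hvr))) rfl
      refine ⟨m, h1.trans (isAncestor_parent hvr), h2, h3, fun z hz hz' => ?_⟩
      rcases hz.eq_or with rfl | ⟨-, hz⟩
      · exact absurd hz' hvv'
      · exact h4 z hz hz'

/-- Uniqueness: if the bags of `v` and `v'` are initial and `S` is their intersection, some edge
of the tree path between `v` and `v'` has intersection `S`, as otherwise the two bags would be
connected outside `S` and have a common source there. So `S` is a forbidden prefix of `v` or of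
`v'`. -/
theorem eq_of_isInitial_bag [Finite V] {D : Digraph V} (hD : IsAMO G D) {v v' : T.Node}
    (hv : IsInitial D (T.bag v)) (hvR : ∀ S ∈ T.forbiddenPrefixes v, ¬ IsInitial D S)
    (hv' : IsInitial D (T.bag v')) (hvR' : ∀ S ∈ T.forbiddenPrefixes v', ¬ IsInitial D S) :
    v = v' := by
  by_contra hne
  set S := T.bag v ∩ T.bag v' with hS
  have hSI : IsInitial D S := fun x s hs hxs => ⟨hv hs.1 hxs, hv' hs.2 hxs⟩
  -- `J x y`: the vertices `x` and `y` have a common ancestor outside `S`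
  let J : V → V → Prop := fun x y =>
    ∃ e, e ∉ S ∧ Relation.ReflTransGen D.Adj e x ∧ Relation.ReflTransGen D.Adj e y
  have hJtrans : ∀ {x y z}, J x y → J y z → J x z := by
    rintro x y z ⟨c, hc, hcx, hcy⟩ ⟨d, hd, hdy, hdz⟩
    rcases hD.reflTransGen_or hcy hdy with h | h
    · exact ⟨c, hc, hcx, h.trans hdz⟩
    · exact ⟨d, hd, h.trans hcx, hdz⟩
  have hJbag : ∀ (x : T.Node) (a b), a ∈ T.bag x → b ∈ T.bag x → a ∉ S → b ∉ S → J a b := by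
    intro x a b ha hb haS hbS
    by_cases hab : a = b
    · subst hab; exact ⟨a, haS, .refl, .refl⟩
    rcases hD.orientation.adj_or (isClique_bag x ha hb hab) with h | h
    · exact ⟨a, haS, .refl, .single h⟩
    · exact ⟨b, hbS, .single h, .refl⟩
  -- edges of the tree path between `v` and `v'` meet the complement of `S`
  have hsep : ∀ z, z ≠ T.root → (T.IsAncestor z v ∧ ¬ T.IsAncestor z v') ∨
      (T.IsAncestor z v' ∧ ¬ T.IsAncestor z v) → ∃ c, c ∈ T.bag (T.parent z) ∩ T.bag z ∧ c ∉ S := by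
    intro z hzr hz
    by_contra hcon
    push Not at hcon
    have hle : S ⊆ T.bag (T.parent z) ∩ T.bag z := by
      intro a ha
      rcases hz with ⟨h1, h2⟩ | ⟨h1, h2⟩
      · exact (mem_bag_of_isAncestor ha.1 ha.2 h1 h2).2
      · exact (mem_bag_of_isAncestor ha.2 ha.1 h1 h2).2
    have heq : S = T.bag (T.parent z) ∩ T.bag z := hle.antisymm hcon
    rcases hz with ⟨h1, -⟩ | ⟨h1, -⟩
    · exact hvR S (mem_forbiddenPrefixes_iff.2 ⟨z, hzr, h1, heq, Set.inter_subset_left⟩) hSI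
    · exact hvR' S (mem_forbiddenPrefixes_iff.2 ⟨z, hzr, h1, heq, Set.inter_subset_right⟩) hSI
  let P : T.Node → Prop := fun x => ∀ a ∈ T.bag v, a ∉ S → ∀ b ∈ T.bag x, b ∉ S → J a b
  have hstep : ∀ x y c, c ∈ T.bag x → c ∈ T.bag y → c ∉ S → P x → P y :=
    fun x y c hx hy hc hP a ha haS b hb hbS =>
      hJtrans (hP a ha haS c hx hc) (hJbag y c b hy hb hc hbS)
  obtain ⟨m, hmv, hmv', hPm, hmax⟩ := exists_common_ancestor (v' := v') P (v := v)
    (fun a ha haS b hb hbS => hJbag v a b ha hb haS hbS)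
    (by
      intro z hz hz' hzr hPz
      obtain ⟨c, hc, hcS⟩ := hsep z hzr (Or.inl ⟨hz, hz'⟩)
      exact hstep z _ c hc.2 hc.1 hcS hPz)
  have hPv' : ∀ y, T.IsAncestor m y → T.IsAncestor y v' → P y := by
    intro y hy
    unfold IsAncestor at hy
    induction hy with
    | refl => exact fun _ => hPm
    | @tail b y hb h ih =>
      obtain ⟨h1, rfl⟩ := h
      intro hyv'
      by_cases hyv : T.IsAncestor y v
      · have : m = y := IsAncestor.antisymm
          (Relation.ReflTransGen.trans hb (isAncestor_parent h1)) (hmax y hyv hyv')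
        exact this ▸ hPm
      · obtain ⟨c, hc, hcS⟩ := hsep y h1 (Or.inr ⟨hyv', hyv⟩)
        exact hstep _ y c hc.1 hc.2 hcS (ih ((isAncestor_parent h1).trans hyv'))
  have hnonempty : ∀ x y : T.Node, x ≠ y → ∃ a ∈ T.bag x, a ∉ T.bag y := by
    intro x y hxy
    by_contra hcon
    push Not at hcon
    exact hxy (bag_subset_iff.1 hcon)
  obtain ⟨a, ha, ha'⟩ := hnonempty v v' hne
  obtain ⟨b, hb, hb'⟩ := hnonempty v' v (Ne.symm hne)
  obtain ⟨e, he, hea, heb⟩ := hPv' v' hmv' .refl a ha (fun h => ha' h.2) b hb (fun h => hb' h.1)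
  have hinit : ∀ K : Set V, IsInitial D K → ∀ x y, Relation.ReflTransGen D.Adj x y → y ∈ K →
      x ∈ K := by
    intro K hK x y hxy hy
    induction hxy using Relation.ReflTransGen.head_induction_on with
    | refl => exact hy
    | head h _ ih => exact hK ih h
  exact he ⟨hinit _ hv _ _ hea ha, hinit _ hv' _ _ heb hb⟩

end RootedCliqueTree

/-! ### The counting formula -/

theorem numAMO_eq_finsum {V : Type u} [Finite V] {G : SimpleGraph V} (hG : IsChordal G)
    (T : RootedCliqueTree.{u, w} G) :
    numAMO G = ∑ᶠ v : T.Node, phi (T.bag v) (T.forbiddenPrefixes v) *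
      ∏ᶠ H ∈ components G (T.bag v), numAMO H.coe := by
  have := T.finite_node
  have := Fintype.ofFinite T.Node
  have : Finite (Digraph V) :=
    Finite.of_injective (fun D : Digraph V => D.Adj) fun _ _ h => Digraph.ext h
  -- the unique node at which an AMO is counted
  choose f hf hfR using fun D : {D : Digraph V // IsAMO G D} => T.exists_isInitial_bag D.2
  have hfib : ∀ v (D : {D // f D = v}), IsInitial D.1.1 (T.bag v) ∧
      ∀ S ∈ T.forbiddenPrefixes v, ¬ IsInitial D.1.1 S := by
    rintro _ ⟨D, rfl⟩
    exact ⟨hf D, hfR D⟩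
  rw [finsum_eq_sum_of_fintype, numAMO_eq_card, ← Nat.card_congr (Equiv.sigmaFiberEquiv f),
    Nat.card_sigma]
  refine Finset.sum_congr rfl fun v _ => ?_
  rw [← numAMO_undirectedRest, ← ncard_isAMO_isInitial hG (RootedCliqueTree.isClique_bag v)]
  · refine Nat.card_congr
      { toFun := fun D => ⟨D.1.1, D.1.2, hfib v D⟩
        invFun := fun D => ⟨⟨D.1, D.2.1⟩,
          RootedCliqueTree.eq_of_isInitial_bag D.2.1 (hf _) (hfR _) D.2.2.1 D.2.2.2⟩
        left_inv := fun _ => rfl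
        right_inv := fun _ => rfl }
  · intro S hS
    obtain ⟨_, _, _, _, h⟩ := RootedCliqueTree.mem_forbiddenPrefixes_iff.1 hS
    exact h

/-! ### Invariance under isomorphism -/

theorem IsAMO.comap {V : Type u} {V' : Type w} {G : SimpleGraph V} {G' : SimpleGraph V'}
    (e : G ≃g G') {D : Digraph V'} (hD : IsAMO G' D) :
    IsAMO G ⟨fun a b => D.Adj (e a) (e b)⟩ :=
  isAMO_of (fun _ _ h => e.map_adj_iff.1 (hD.orientation.1 _ _ h))
    (fun _ _ h => hD.orientation.adj_or (e.map_adj_iff.2 h))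
    (fun v hv => hD.acyclic (e v) (hv.lift e fun _ _ h => h))
    (fun _ _ _ hab hcb hac => e.map_adj_iff.1 (hD.adj_of_adj hab hcb fun h => hac (e.injective h)))

theorem numAMO_congr {V : Type u} {V' : Type w} {G : SimpleGraph V} {G' : SimpleGraph V'}
    (e : G ≃g G') : numAMO G = numAMO G' :=
  Nat.card_congr
    { toFun := fun D => ⟨_, D.2.comap e.symm⟩
      invFun := fun D => ⟨_, D.2.comap e⟩
      left_inv := fun D => by
        refine Subtype.ext (Digraph.ext ?_)
        funext a b
        simp
      right_inv := fun D => by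
        refine Subtype.ext (Digraph.ext ?_)
        funext a b
        simp }

/-- A subgraph of a subgraph is isomorphic to its image in the ambient graph. -/
noncomputable def isoCoeSubgraph {V : Type u} {G : SimpleGraph V} {H : G.Subgraph}
    (H' : H.coe.Subgraph) : H'.coe ≃g (Subgraph.coeSubgraph H').coe :=
  Copy.isoSubgraphMap ⟨H.hom, Subgraph.hom_injective⟩ H'

theorem isChordal_coe_of_mem_components {V : Type u} [Finite V] {G : SimpleGraph V}
    (hG : IsChordal G) {K : Set V} (hK : G.IsClique K) {H : G.Subgraph}
    (hH : H ∈ components G K) : IsChordal H.coe := by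
  obtain ⟨x, _, rfl⟩ := hH
  refine IsChordal.of_embedding (G := undirectedRest G K) ⟨Function.Embedding.subtype _, ?_⟩
    ((isInducedOnComponents_undirectedRest hG hK).isChordal hG)
  intro a b
  exact ⟨fun h => ⟨a.2, h⟩, fun h => h.2⟩

theorem ncard_verts_lt_of_mem_components {V : Type u} [Finite V] {G : SimpleGraph V}
    (T : RootedCliqueTree.{u, w} G) {v : T.Node} {H : G.Subgraph}
    (hH : H ∈ components G (T.bag v)) : H.verts.ncard < Nat.card V := by
  obtain ⟨x, hx, rfl⟩ := hH
  obtain ⟨z, hz⟩ : (T.bag v).Nonempty := by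
    by_contra hne
    rw [Set.not_nonempty_iff_eq_empty] at hne
    have h := (T.bag_bijOn.mapsTo (Set.mem_univ v)).2 (y := {x}) (by simp) (by simp [hne])
    exact hx (h rfl)
  rw [← Set.ncard_univ]
  refine Set.ncard_lt_ncard ⟨Set.subset_univ _, fun h => ?_⟩
  exact notMem_of_undirectedRest_reachable hx (h (Set.mem_univ z)) hz

/-! ### Correctness of the algorithm -/

section
variable {V : Type u} {G : SimpleGraph V}

/-- All runs from the state are finite and end with the return of `n` by the outermost call. -/
inductive Returns (n : ℕ) : State.{u, w} G → Prop
  | intro (s : State.{u, w} G) (h : ∀ s', Step s s' → Returns n s')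
      (h' : (∃ s', Step s s') ∨ ∃ memo, s = ⟨.ret n, [], memo⟩) : Returns n s

theorem alwaysReturns_of_returns {n : ℕ} (h : Returns n (initialState.{u, w} G)) :
    AlwaysReturns.{u, w} G n := by
  constructor
  · rintro ⟨s, h0, hs⟩
    have key : ∀ t, Returns n t → ∀ i, s i ≠ t := by
      intro t ht
      induction ht with
      | intro t _ _ ih =>
        rintro i rfl
        exact ih _ (hs i) (i + 1) rfl
    exact key _ h 0 h0
  · intro s hs
    have : Returns n s := by
      induction hs with
      | refl => exact h
      | tail _ hst ih =>
        cases ih with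
        | intro _ h _ => exact h _ hst
    cases this with
    | intro _ _ h' => exact h'

/-- All entries of the table are correct. -/
def ValidMemo (memo : G.Subgraph → Option ℕ) : Prop :=
  ∀ H n, memo H = some n → n = numAMO H.coe

theorem ValidMemo.memoSet {memo : G.Subgraph → Option ℕ} (h : ValidMemo memo) (H : G.Subgraph) :
    ValidMemo (memoSet memo H (numAMO H.coe)) := by
  intro H' n hn
  let := Classical.decEq G.Subgraph
  change Function.update memo H (some (numAMO H.coe)) H' = some n at hn
  by_cases hH : H' = H
  · subst hH
    rw [Function.update_self] at hn
    exact (Option.some_injective _ hn).symm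
  · rw [Function.update_of_ne hH] at hn
    exact h H' n hn

theorem exists_isPermutationOf {α : Type*} {S : Set α} (hS : S.Finite) :
    ∃ l : List α, IsPermutationOf l S := by
  obtain ⟨s, rfl⟩ := hS.exists_finset_coe
  exact ⟨s.toList, s.nodup_toList, fun x => by simp⟩

/-- The contract of `count(H)`: the call behaves as if it returned `#AMO(H)` at once, leaving a
correct table. -/
def CallSpec (n : ℕ) (H : G.Subgraph) : Prop :=
  ∀ (stack : List (Frame.{u, w} G)) (memo : G.Subgraph → Option ℕ), ValidMemo memo →
    (∀ memo', ValidMemo memo' → Returns n ⟨.ret (numAMO H.coe), stack, memo'⟩) →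
    Returns n ⟨.call H, stack, memo⟩

theorem returns_forEach {n : ℕ} (H : G.Subgraph) (T : RootedCliqueTree.{u, w} H.coe)
    (queue : List T.Node) (sum : ℕ) (v : T.Node) (stack : List (Frame.{u, w} G))
    (todo : List G.Subgraph) (hspec : ∀ H' ∈ todo, CallSpec.{u, w} n H') (prod : ℕ)
    (memo : G.Subgraph → Option ℕ) (hmemo : ValidMemo memo)
    (hret : ∀ memo', ValidMemo memo' → Returns n ⟨.whileLoop H T queue
      (sum + phi (T.bag v) (T.forbiddenPrefixes v) *
        (prod * (todo.map fun H' => numAMO H'.coe).prod)), stack, memo'⟩) :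
    Returns n ⟨.forEach ⟨H, T, queue, sum, v, todo, prod⟩, stack, memo⟩ := by
  induction todo generalizing prod memo with
  | nil =>
    refine .intro _ (fun s' hs' => ?_) (Or.inl ⟨_, .addTerm ..⟩)
    cases hs' with
    | addTerm => simpa using hret memo hmemo
  | cons H' todo ih =>
    refine .intro _ (fun s' hs' => ?_) (Or.inl ⟨_, .recurse ..⟩)
    cases hs' with
    | recurse =>
      refine hspec H' (by simp) _ _ hmemo fun memo' hmemo' => ?_
      refine .intro _ (fun s' hs' => ?_) (Or.inl ⟨_, .resume ..⟩)
      cases hs' with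
      | resume =>
        refine ih (fun H'' h => hspec H'' (by simp [h])) _ _ hmemo' fun memo'' hmemo'' => ?_
        simpa [mul_assoc] using hret memo'' hmemo''

/-- The invariant of the while loop: the nodes popped so far form the set `P`, all other nodes
reachable by one edge from `P` are in the queue, and no node is ever pushed twice. -/
structure LoopInvariant {H : G.Subgraph} (T : RootedCliqueTree.{u, w} H.coe) (P : Finset T.Node)
    (queue : List T.Node) : Prop where
  nodup : queue.Nodup
  notMem : ∀ x ∈ queue, x ∉ P
  root : T.root ∈ P ∨ T.root ∈ queue
  children : ∀ x ∈ P, ∀ y ∈ T.children x, y ∈ P ∨ y ∈ queue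
  parent : ∀ y, y ≠ T.root → y ∈ P ∨ y ∈ queue → T.parent y ∈ P

theorem LoopInvariant.mem {H : G.Subgraph} {T : RootedCliqueTree.{u, w} H.coe}
    {P : Finset T.Node} (h : LoopInvariant T P []) (x : T.Node) : x ∈ P := by
  induction hn : T.depth x using Nat.strong_induction_on generalizing x with
  | _ n ih =>
    by_cases hx : x = T.root
    · exact hx ▸ (h.root.resolve_right (by simp))
    · have hd := RootedCliqueTree.depth_parent hx
      exact (h.children _ (ih _ (by omega) _ rfl) x
        (RootedCliqueTree.mem_children_iff.2 ⟨hx, rfl⟩)).resolve_right (by simp)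

theorem LoopInvariant.pop {H : G.Subgraph} {T : RootedCliqueTree.{u, w} H.coe}
    {P P' : Finset T.Node} {v : T.Node} {queue newNodes : List T.Node}
    (h : LoopInvariant T P (v :: queue)) (hP' : ∀ x, x ∈ P' ↔ x = v ∨ x ∈ P)
    (hn : IsPermutationOf newNodes (T.children v)) :
    LoopInvariant T P' (queue ++ newNodes) := by
  have hq := List.nodup_cons.1 h.nodup
  have hnew : ∀ x, x ∈ newNodes ↔ x ≠ T.root ∧ T.parent x = v := fun x =>
    (hn.2 x).trans RootedCliqueTree.mem_children_iff
  have hvP : v ∉ P := h.notMem v (by simp)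
  -- the parent of a node seen before has been popped before, so it is not `v`
  have hold : ∀ x ∈ newNodes, ¬ (x ∈ P ∨ x ∈ v :: queue) := fun x hx hx' =>
    hvP (((hnew x).1 hx).2 ▸ h.parent x ((hnew x).1 hx).1 hx')
  have hmem : ∀ x, (x ∈ P' ∨ x ∈ queue ++ newNodes) ↔
      ((x ∈ P ∨ x ∈ v :: queue) ∨ x ∈ newNodes) := by
    intro x
    rw [hP', List.mem_append, List.mem_cons]
    tauto
  constructor
  · rw [List.nodup_append]
    refine ⟨hq.2, hn.1, ?_⟩
    rintro a ha _ hb rfl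
    exact hold a hb (Or.inr (List.mem_cons_of_mem _ ha))
  · intro x hx hxP'
    rcases (hP' x).1 hxP' with rfl | hxP
    · rcases List.mem_append.1 hx with h1 | h1
      · exact hq.1 h1
      · exact hold _ h1 (Or.inr (by simp))
    · rcases List.mem_append.1 hx with h1 | h1
      · exact h.notMem x (List.mem_cons_of_mem _ h1) hxP
      · exact hold x h1 (Or.inl hxP)
  · exact (hmem _).2 (Or.inl h.root)
  · intro x hx y hy
    rw [hmem]
    rcases (hP' x).1 hx with rfl | hxP
    · exact Or.inr ((hn.2 y).2 hy)
    · exact Or.inl (h.children x hxP y hy)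
  · intro y hyr hy
    rw [hP']
    rcases (hmem y).1 hy with h1 | h1
    · exact Or.inr (h.parent y hyr h1)
    · exact Or.inl ((hnew y).1 h1).2

theorem prod_numAMO_coeSubgraph {H : G.Subgraph} {C : Set H.coe.Subgraph} {todo : List G.Subgraph}
    (ht : IsPermutationOf todo (Subgraph.coeSubgraph '' C)) :
    (todo.map fun H' => numAMO H'.coe).prod = ∏ᶠ H' ∈ C, numAMO H'.coe := by
  classical
  have h1 : (todo.toFinset : Set G.Subgraph) = Subgraph.coeSubgraph '' C := by
    ext x
    simpa using ht.2 x
  rw [← List.prod_toFinset _ ht.1, ← finprod_mem_coe_finset, h1,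
    finprod_mem_image (Subgraph.coeSubgraph_injective H).injOn]
  exact finprod_mem_congr rfl fun H' _ => (numAMO_congr (isoCoeSubgraph H')).symm

theorem returns_whileLoop [Finite V] {n : ℕ} (H : G.Subgraph) (hH : IsChordal H.coe)
    (hspec : ∀ H' : G.Subgraph, IsChordal H'.coe → H'.verts.ncard < H.verts.ncard →
      CallSpec.{u, w} n H')
    (T : RootedCliqueTree.{u, w} H.coe) (stack : List (Frame.{u, w} G))
    (hret : ∀ memo', ValidMemo memo' → Returns n ⟨.ret (numAMO H.coe), stack, memo'⟩)
    (P : Finset T.Node) (queue : List T.Node) (hinv : LoopInvariant T P queue)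
    (memo : G.Subgraph → Option ℕ) (hmemo : ValidMemo memo) :
    Returns n ⟨.whileLoop H T queue (∑ v ∈ P, phi (T.bag v) (T.forbiddenPrefixes v) *
      ∏ᶠ H' ∈ components H.coe (T.bag v), numAMO H'.coe), stack, memo⟩ := by
  classical
  have := T.finite_node
  have := Fintype.ofFinite T.Node
  induction hk : Pᶜ.card using Nat.strong_induction_on generalizing P queue memo with
  | _ k ih =>
    subst hk
    rcases queue with _ | ⟨v, queue⟩
    · have hsum : (∑ v ∈ P, phi (T.bag v) (T.forbiddenPrefixes v) *
          ∏ᶠ H' ∈ components H.coe (T.bag v), numAMO H'.coe) = numAMO H.coe := by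
        rw [numAMO_eq_finsum hH T, finsum_eq_sum_of_fintype]
        exact Finset.sum_congr (Finset.eq_univ_of_forall hinv.mem) fun _ _ => rfl
      rw [hsum]
      refine .intro _ (fun s' hs' => ?_) (Or.inl ⟨_, .finish ..⟩)
      cases hs' with
      | finish => exact hret _ (hmemo.memoSet H)
    · have hvP : v ∉ P := hinv.notMem v (by simp)
      refine .intro _ (fun s' hs' => ?_) (Or.inl ?_)
      · cases hs' with
        | pop _ _ _ _ _ _ _ newNodes hn todo ht =>
          refine returns_forEach H T _ _ v stack todo (fun H' hH' => ?_) 1 memo hmemo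
            fun memo' hmemo' => ?_
          · obtain ⟨H'', hC, rfl⟩ := (ht.2 H').1 hH'
            refine hspec _ ?_ ?_
            · exact IsChordal.of_embedding (isoCoeSubgraph H'').symm.toEmbedding
                (isChordal_coe_of_mem_components hH (RootedCliqueTree.isClique_bag v) hC)
            · rw [Subgraph.verts_coeSubgraph, Set.ncard_image_of_injective _
                Subtype.val_injective]
              exact ncard_verts_lt_of_mem_components T hC
          · have hlt : (insert v P)ᶜ.card < Pᶜ.card :=
              Finset.card_lt_card (Finset.compl_ssubset_compl.2 (Finset.ssubset_insert hvP))
            have := ih _ hlt (insert v P) _ (hinv.pop (by simp) hn) memo' hmemo' rfl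
            rw [Finset.sum_insert hvP, add_comm] at this
            rwa [one_mul, prod_numAMO_coeSubgraph ht]
      · obtain ⟨newNodes, hn⟩ := exists_isPermutationOf (Set.toFinite (T.children v))
        obtain ⟨todo, ht⟩ := exists_isPermutationOf
          (Set.toFinite (Subgraph.coeSubgraph '' components H.coe (T.bag v)))
        exact ⟨_, .pop _ _ _ _ _ _ _ newNodes hn todo ht⟩

theorem callSpec [Finite V] (n : ℕ) (H : G.Subgraph) (hH : IsChordal H.coe) :
    CallSpec.{u, w} n H := by
  induction hk : H.verts.ncard using Nat.strong_induction_on generalizing H with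
  | _ k ih =>
    subst hk
    intro stack memo hmemo hret
    rcases hm : memo H with _ | m
    · obtain ⟨T⟩ := hH.nonempty_rootedCliqueTree
      refine .intro _ (fun s' hs' => ?_) (Or.inl ⟨_, .start _ _ _ hm T⟩)
      cases hs' with
      | lookup _ _ _ _ h => rw [hm] at h; cases h
      | start _ _ _ _ T =>
        have := returns_whileLoop H hH (fun H' hH' hlt => ih _ hlt H' hH' rfl) T stack hret ∅
          [T.root] ⟨by simp, by simp, by simp, by simp, by simp⟩ memo hmemo
        simpa using this
    · refine .intro _ (fun s' hs' => ?_) (Or.inl ⟨_, .lookup _ _ _ m hm⟩)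
      cases hs' with
      | lookup _ _ _ m' h =>
        rw [hmemo H m' h]
        exact hret memo hmemo
      | start _ _ _ h => rw [hm] at h; cases h

theorem alwaysReturns_numAMO [Finite V] (hG : IsChordal G) :
    AlwaysReturns.{u, w} G (numAMO G) := by
  refine alwaysReturns_of_returns (callSpec _ ⊤
    (IsChordal.of_embedding Subgraph.topIso.toEmbedding hG) [] _ (by simp [ValidMemo])
    fun memo' _ => ?_)
  rw [numAMO_congr Subgraph.topIso]
  exact .intro _ (fun s' hs' => by cases hs') (Or.inr ⟨memo', rfl⟩)

end

end CliquePicking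

theorem mainTheorem3 {V : Type u} [Finite V] (G : SimpleGraph V) (hG : CliquePicking.IsUCCG G) :
    (∀ T : CliquePicking.RootedCliqueTree.{u, w} G,
      CliquePicking.numAMO G =
        ∑ᶠ v : T.Node, CliquePicking.phi (T.bag v) (T.forbiddenPrefixes v) *
          ∏ᶠ H ∈ CliquePicking.components G (T.bag v), CliquePicking.numAMO H.coe) ∧
    CliquePicking.AlwaysReturns.{u, w} G (CliquePicking.numAMO G) :=
  ⟨fun T => CliquePicking.numAMO_eq_finsum hG.chordal T,
    CliquePicking.alwaysReturns_numAMO hG.chordal⟩
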